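/- Let $\{\boldsymbol\xi_{k,j,i}, \boldsymbol\varepsilon_k : k,j\in\mathbb N,\ i\in\{1,2\}\}$ ($\mathbb N=\{1,2,\dots\}$) be independent random vectors on a probability space with values in $\mathbb Z_+^2$, such that for each $i\in\{1,2\}$ the vectors $\boldsymbol\xi_{k,j,i}$, $k,j\in\mathbb N$, are identically distributed, and the vectors $\boldsymbol\varepsilon_k$, $k\in\mathbb N$, are identically distributed. Let $(\boldsymbol X_k)_{k\ge 0}$, $\boldsymbol X_k=(X_{k,1},X_{k,2})^\top$, be the 2-type Galton--Watson process with immigration $$\boldsymbol X_0=\boldsymbol 0,\qquad \boldsymbol X_k=\sum_{j=1}^{X_{k-1,1}}\boldsymbol\xi_{k,j,1}+\sum_{j=1}^{X_{k-1,2}}\boldsymbol\xi_{k,j,2}+\boldsymbol\varepsilon_k,\qquad k\in\mathbb N.$$ Assume $\mathbb E\|\boldsymbol\xi_{1,1,1}\|^8<\infty$, $\mathbb E\|\boldsymbol\xi_{1,1,2}\|^8<\infty$, $\mathbb E\|\boldsymbol\varepsilon_1\|^8<\infty$, $\mathbb E(\boldsymbol\varepsilon_1)\neq\boldsymbol 0$,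 and that the process is doubly symmetric and critical, i.e. $\mathbb E(\boldsymbol\xi_{1,1,1})=(\alpha,\beta)^\top$ and $\mathbb E(\boldsymbol\xi_{1,1,2})=(\beta,\alpha)^\top$ with $(\alpha,\beta)\in(0,1)^2$ and $\alpha+\beta=1$. Put $\overline{\boldsymbol V}_{\boldsymbol\xi}:=\frac12\bigl(\operatorname{Var}(\boldsymbol\xi_{1,1,1})+\operatorname{Var}(\boldsymbol\xi_{1,1,2})\bigr)\in\mathbb R^{2\times2}$ (covariance matrices), $\tilde{\boldsymbol u}:=(1,-1)^\top$, $U_k:=X_{k,1}+X_{k,2}$ and $V_k:=X_{k,1}-X_{k,2}$. Then $$n^{-2}\left(\sum_{k=1}^n V_k^2-\frac{\langle\overline{\boldsymbol V}_{\boldsymbol\xi}\tilde{\boldsymbol u},\tilde{\boldsymbol u}\rangle}{4\alpha\beta}\sum_{k=1}^n U_{k-1}\right)\to 0\quad\text{in probability as } n\to\infty.$$ -/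

import Mathlib

open MeasureTheory ProbabilityTheory

namespace GWI

noncomputable section

variable {Ω : Type*} [MeasurableSpace Ω]

/-- The 2-type Galton--Watson process with immigration started from zero. Types are elements of
`Fin 2`. All indices are counted from `0`: `ξ k j i ω ℓ` is the number of type `ℓ` offspring of the
`j`-th individual of type `i` of generation `k` (so these offspring belong to generation `k + 1`),
and `ε k ω ℓ` is the number of type `ℓ` immigrants in generation `k + 1`. -/
def process (ξ : ℕ → ℕ → Fin 2 → Ω → (Fin 2 → ℕ)) (ε : ℕ → Ω → (Fin 2 → ℕ)) :
    ℕ → Ω → (Fin 2 → ℕ)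
  | 0, _ => 0
  | k + 1, ω =>
      ∑ i : Fin 2, ∑ j ∈ Finset.range (process ξ ε k ω i), ξ k j i ω + ε k ω

/-- A vector of natural numbers regarded as a vector of `ℝ²`. -/
def toReal (x : Fin 2 → ℕ) : Fin 2 → ℝ := fun i => (x i : ℝ)

/-- The Euclidean norm of a vector of natural numbers. -/
def euclNorm (x : Fin 2 → ℕ) : ℝ := ‖(WithLp.toLp 2 (toReal x) : EuclideanSpace ℝ (Fin 2))‖

/-- The vector of expectations of a random vector. -/
def meanVec (μ : Measure Ω) (Y : Ω → (Fin 2 → ℕ)) : Fin 2 → ℝ :=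
  fun ℓ => ∫ ω, (Y ω ℓ : ℝ) ∂μ

/-- The covariance matrix of a random vector. -/
def covMatrix (μ : Measure Ω) (Y : Ω → (Fin 2 → ℕ)) : Matrix (Fin 2) (Fin 2) ℝ :=
  Matrix.of fun a b => covariance (fun ω => (Y ω a : ℝ)) (fun ω => (Y ω b : ℝ)) μ

/-- The offspring mean matrix; its `i`-th column is the mean offspring vector of type `i`. -/
def offspringMean (μ : Measure Ω) (ξ : ℕ → ℕ → Fin 2 → Ω → (Fin 2 → ℕ)) :
    Matrix (Fin 2) (Fin 2) ℝ :=
  Matrix.of fun ℓ i => meanVec μ (ξ 0 0 i) ℓ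

/-- The average of the two offspring covariance matrices. -/
def avgOffspringCov (μ : Measure Ω) (ξ : ℕ → ℕ → Fin 2 → Ω → (Fin 2 → ℕ)) :
    Matrix (Fin 2) (Fin 2) ℝ :=
  (1 / 2 : ℝ) • (covMatrix μ (ξ 0 0 0) + covMatrix μ (ξ 0 0 1))

/-- The vector `(1, 1)`. -/
def oneVec : Fin 2 → ℝ := ![1, 1]

/-- The vector `(1, -1)`. -/
def uTilde : Fin 2 → ℝ := ![1, -1]

/-- `U_k = ⟨(1, 1), X_k⟩`. -/
def U (ξ : ℕ → ℕ → Fin 2 → Ω → (Fin 2 → ℕ)) (ε : ℕ → Ω → (Fin 2 → ℕ)) (k : ℕ) (ω : Ω) : ℝ :=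
  oneVec ⬝ᵥ toReal (process ξ ε k ω)

/-- `V_k = ⟨(1, -1), X_k⟩`. -/
def V (ξ : ℕ → ℕ → Fin 2 → Ω → (Fin 2 → ℕ)) (ε : ℕ → Ω → (Fin 2 → ℕ)) (k : ℕ) (ω : Ω) : ℝ :=
  uTilde ⬝ᵥ toReal (process ξ ε k ω)

/-- The family of all offspring vectors and all immigration vectors. -/
def family (ξ : ℕ → ℕ → Fin 2 → Ω → (Fin 2 → ℕ)) (ε : ℕ → Ω → (Fin 2 → ℕ)) :
    (ℕ × ℕ × Fin 2) ⊕ ℕ → Ω → (Fin 2 → ℕ) :=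
  Sum.elim (fun p => ξ p.1 p.2.1 p.2.2) ε

end

end GWI

/-! Let `δ = α - β`, so `|δ| < 1` and `1 - δ² = 4αβ`. Since `(1,-1)` is a left eigenvector of the
mean matrix, `V_{k+1} = δ V_k + m + M_{k+1}`, where `m` is the mean of `⟨(1,-1), ε⟩` and `M_{k+1}`
is a martingale difference (`innovation`). The conditional variance of `M_{k+1}` is linear in `X_k`,
hence a combination of `U_k`, `V_k` and a constant, and the coefficient of `U_k` is the quadratic
form in the theorem. Squaring the recursion and summing gives the exact identity
`sum_V_sq_sub_sum_U`: up to the factor `4αβ`, the difference to be estimated is a combination of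
`V_n²`, `∑ V_k`, a martingale and a term linear in `n`.

It remains to see that each of these has second moment `O(n³)`; Chebyshev's inequality then
suffices, because the normalisation `n²` contributes `n⁴`. Criticality gives `E U_k² = O(k²)`. Given
`X_k`, the innovation is a sum of about `U_k` independent centered terms, so its fourth moment is
`O(k²)`; the contraction by `δ` passes this on to `E V_k⁴ = O(k²)`. Orthogonality of the martingale
differences handles their sum.

Conditioning on `X_k` is done by splitting `Ω` into the countably many events `X_k = x`. -/

namespace GWI

/-! ### Second and fourth moments of sums of independent centered variables. -/

section IndependentSums

variable {Ω ι : Type*} [MeasurableSpace Ω] {μ : Measure Ω}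
  {Z : ι → Ω → ℝ}

lemma integrable_pow_of_memLp_four [IsProbabilityMeasure μ] {f : Ω → ℝ} (hf : MemLp f 4 μ) {p : ℕ} (hp : p ≤ 4) :
    Integrable (fun ω => f ω ^ p) μ := by
  have h : MemLp f p μ := hf.mono_exponent (by exact_mod_cast hp)
  refine (integrable_norm_iff (hf.1.pow p)).1 ?_
  simpa [norm_pow] using h.integrable_norm_pow'

lemma integral_sum_of_centered [IsProbabilityMeasure μ] (h4 : ∀ i, MemLp (Z i) 4 μ) (h0 : ∀ i, ∫ ω, Z i ω ∂μ = 0)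
    (s : Finset ι) : ∫ ω, ∑ i ∈ s, Z i ω ∂μ = 0 := by
  rw [integral_finsetSum _ fun i _ => (h4 i).integrable (by norm_num)]
  simp [h0]

lemma indepFun_sum_pow (hZ : iIndepFun Z μ) (hm : ∀ i, Measurable (Z i)) {s : Finset ι} {a : ι}
    (ha : a ∉ s) (p q : ℕ) :
    IndepFun (fun ω => (∑ i ∈ s, Z i ω) ^ p) (fun ω => Z a ω ^ q) μ := by
  have h := hZ.indepFun_finsetSum_of_notMem hm ha
  have h' := h.comp (measurable_id.pow_const p) (measurable_id.pow_const q)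
  convert h' using 1 <;> ext ω <;> simp [Finset.sum_apply]

lemma integral_sum_pow_mul (hZ : iIndepFun Z μ) (hm : ∀ i, Measurable (Z i))
    {s : Finset ι} {a : ι} (ha : a ∉ s) (p q : ℕ) :
    ∫ ω, (∑ i ∈ s, Z i ω) ^ p * Z a ω ^ q ∂μ =
      (∫ ω, (∑ i ∈ s, Z i ω) ^ p ∂μ) * ∫ ω, Z a ω ^ q ∂μ :=
  (indepFun_sum_pow hZ hm ha p q).integral_fun_mul_eq_mul_integral
    ((Finset.measurable_fun_sum s fun i _ => hm i).pow_const p).aestronglyMeasurable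
    ((hm a).pow_const q).aestronglyMeasurable

lemma integrable_sum_pow_mul [IsProbabilityMeasure μ] (hZ : iIndepFun Z μ) (hm : ∀ i, Measurable (Z i))
    (h4 : ∀ i, MemLp (Z i) 4 μ)
    {s : Finset ι} {a : ι} (ha : a ∉ s) {p q : ℕ} (hp : p ≤ 4) (hq : q ≤ 4) :
    Integrable (fun ω => (∑ i ∈ s, Z i ω) ^ p * Z a ω ^ q) μ :=
  (indepFun_sum_pow hZ hm ha p q).integrable_mul
    (integrable_pow_of_memLp_four (memLp_finsetSum s fun i _ => h4 i) hp)
    (integrable_pow_of_memLp_four (h4 a) hq)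

lemma integral_sum_sq_of_centered [IsProbabilityMeasure μ] (hZ : iIndepFun Z μ) (hm : ∀ i, Measurable (Z i))
    (h4 : ∀ i, MemLp (Z i) 4 μ) (h0 : ∀ i, ∫ ω, Z i ω ∂μ = 0) (s : Finset ι) :
    ∫ ω, (∑ i ∈ s, Z i ω) ^ 2 ∂μ = ∑ i ∈ s, ∫ ω, Z i ω ^ 2 ∂μ := by
  classical
  induction s using Finset.induction_on with
  | empty => simp
  | insert a s ha ih =>
    have hexp : ∀ ω, (∑ i ∈ insert a s, Z i ω) ^ 2 =
        (∑ i ∈ s, Z i ω) ^ 2 + 2 * ((∑ i ∈ s, Z i ω) ^ 1 * Z a ω ^ 1) + Z a ω ^ 2 := by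
      intro ω; rw [Finset.sum_insert ha]; ring
    have i1 : Integrable (fun ω => (∑ i ∈ s, Z i ω) ^ 2) μ :=
      integrable_pow_of_memLp_four (memLp_finsetSum s fun i _ => h4 i) (by norm_num)
    have i2 := (integrable_sum_pow_mul hZ hm h4 ha (p := 1) (q := 1) (by norm_num)
      (by norm_num)).const_mul 2
    have i3 : Integrable (fun ω => Z a ω ^ 2) μ := integrable_pow_of_memLp_four (h4 a) (by norm_num)
    simp_rw [hexp]
    rw [integral_add (i1.fun_add i2) i3, integral_add i1 i2, integral_const_mul,
      integral_sum_pow_mul hZ hm ha, ih, Finset.sum_insert ha]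
    simp [h0, add_comm]

/-- Of the binomial terms of `(S + Z)⁴`, those with a first power of `S` or `Z` vanish. Adding a
summand thus costs at most `6K²|s| + K`, which is below the increment `3K²(2|s| + 1)` of the bound
since `K ≥ 1`. -/
lemma integral_sum_pow_four_le [IsProbabilityMeasure μ] (hZ : iIndepFun Z μ) (hm : ∀ i, Measurable (Z i))
    (h4 : ∀ i, MemLp (Z i) 4 μ) (h0 : ∀ i, ∫ ω, Z i ω ∂μ = 0) {K : ℝ} (hK : 1 ≤ K)
    (hK2 : ∀ i, ∫ ω, Z i ω ^ 2 ∂μ ≤ K) (hK4 : ∀ i, ∫ ω, Z i ω ^ 4 ∂μ ≤ K) (s : Finset ι) :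
    ∫ ω, (∑ i ∈ s, Z i ω) ^ 4 ∂μ ≤ 3 * K ^ 2 * (s.card : ℝ) ^ 2 := by
  classical
  induction s using Finset.induction_on with
  | empty => simp
  | insert a s ha ih =>
    have hexp : ∀ ω, (∑ i ∈ insert a s, Z i ω) ^ 4 =
        (∑ i ∈ s, Z i ω) ^ 4 + 4 * ((∑ i ∈ s, Z i ω) ^ 3 * Z a ω ^ 1)
          + 6 * ((∑ i ∈ s, Z i ω) ^ 2 * Z a ω ^ 2)
          + 4 * ((∑ i ∈ s, Z i ω) ^ 1 * Z a ω ^ 3) + Z a ω ^ 4 := by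
      intro ω; rw [Finset.sum_insert ha]; ring
    have i1 : Integrable (fun ω => (∑ i ∈ s, Z i ω) ^ 4) μ :=
      integrable_pow_of_memLp_four (memLp_finsetSum s fun i _ => h4 i) le_rfl
    have i2 := (integrable_sum_pow_mul hZ hm h4 ha (p := 3) (q := 1) (by norm_num)
      (by norm_num)).const_mul 4
    have i3 := (integrable_sum_pow_mul hZ hm h4 ha (p := 2) (q := 2) (by norm_num)
      (by norm_num)).const_mul 6
    have i4 := (integrable_sum_pow_mul hZ hm h4 ha (p := 1) (q := 3) (by norm_num)
      (by norm_num)).const_mul 4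
    have i5 : Integrable (fun ω => Z a ω ^ 4) μ := integrable_pow_of_memLp_four (h4 a) le_rfl
    have hs2 : ∫ ω, (∑ i ∈ s, Z i ω) ^ 2 ∂μ ≤ s.card * K := by
      rw [integral_sum_sq_of_centered hZ hm h4 h0]
      simpa using Finset.sum_le_card_nsmul s _ K fun i _ => hK2 i
    have hz2 : 0 ≤ ∫ ω, Z a ω ^ 2 ∂μ := integral_nonneg fun ω => sq_nonneg _
    have hmul : (∫ ω, (∑ i ∈ s, Z i ω) ^ 2 ∂μ) * ∫ ω, Z a ω ^ 2 ∂μ ≤ s.card * K * K :=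
      mul_le_mul hs2 (hK2 a) hz2 (by positivity)
    simp_rw [hexp]
    rw [integral_add (((i1.fun_add i2).fun_add i3).fun_add i4) i5,
      integral_add ((i1.fun_add i2).fun_add i3) i4, integral_add (i1.fun_add i2) i3, integral_add i1 i2]
    simp only [integral_const_mul]
    rw [integral_sum_pow_mul hZ hm ha, integral_sum_pow_mul hZ hm ha,
      integral_sum_pow_mul hZ hm ha]
    simp only [pow_one, h0, integral_sum_of_centered h4 h0, mul_zero, zero_mul, add_zero]
    rw [Finset.card_insert_of_notMem ha]
    push_cast
    nlinarith [hK4 a]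

end IndependentSums

/-! ### Conditioning on a variable with countably many values. -/

section Conditioning

variable {Ω E : Type*} {m m₀ : MeasurableSpace Ω} {μ : Measure Ω}
  [Countable E] [MeasurableSpace E] [MeasurableSingletonClass E] {X : Ω → E} {G : E → Ω → E}

/-- On the fibre `X = x` the random map `G (X ω)` is the fixed map `G x`, which is independent of
the fibre because the latter lies in `m`. Summing over `x` replaces a conditional expectation. -/
lemma lintegral_comp_eq_tsum (hm : m ≤ m₀) (hX : Measurable[m] X) (hG : ∀ x, Measurable (G x))
    (hind : ∀ x, Indep m (MeasurableSpace.comap (G x) inferInstance) μ)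
    (F : E → E → ENNReal) :
    ∫⁻ ω, F (X ω) (G (X ω) ω) ∂μ = ∑' x, μ (X ⁻¹' {x}) * ∫⁻ ω, F x (G x ω) ∂μ := by
  have hXm : ∀ x, MeasurableSet[m] (X ⁻¹' {x}) := fun x => hX (measurableSet_singleton x)
  have hX₀ : ∀ x, MeasurableSet (X ⁻¹' {x}) := fun x => hm _ (hXm x)
  have hu : (⋃ x, X ⁻¹' {x}) = Set.univ := by ext; simp
  rw [← setLIntegral_univ, ← hu, lintegral_iUnion hX₀
    (fun x y hxy => Disjoint.preimage _ (by simpa using hxy))]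
  refine tsum_congr fun x => ?_
  rw [setLIntegral_congr_fun (g := fun ω => F x (G x ω)) (hX₀ x)
    (fun ω hω => by simp only [Set.mem_preimage, Set.mem_singleton_iff] at hω; simp [hω])]
  have := lintegral_mul_indicator_eq_lintegral_mul_lintegral_indicator
    (μ := μ) (Mf := MeasurableSpace.comap (G x) inferInstance) (hG x).comap_le
    (f := fun ω => F x (G x ω)) 1 (hX₀ x)
    (indepSets_of_indepSets_of_le_right ((Indep_iff_IndepSets _ _ μ).1 (hind x).symm)
      (Set.singleton_subset_iff.2 (hXm x)))
    ((measurable_of_countable (F x)).comp (comap_measurable (G x)))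
  rw [← lintegral_indicator (hX₀ x)]
  rw [lintegral_indicator (hX₀ x), lintegral_const, one_mul, Measure.restrict_apply_univ] at this
  rw [mul_comm, ← this]
  refine lintegral_congr fun ω => ?_
  by_cases h : ω ∈ X ⁻¹' {x} <;> simp [h]

/-- Both sides are sums over `x` with the same weights, so the hypothesis compares them term by
term. Working with `ENNReal` integrals makes integrability of the left side a consequence. -/
lemma integrable_comp_and_integral_le [IsProbabilityMeasure μ] (hm : m ≤ m₀) (hX : Measurable[m] X)
    (hG : ∀ x, Measurable (G x)) (hY : Measurable fun ω => G (X ω) ω)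
    (hind : ∀ x, Indep m (MeasurableSpace.comap (G x) inferInstance) μ)
    {F : E → E → ℝ} {h : E → ℝ} (hF0 : ∀ x y, 0 ≤ F x y)
    (hFi : ∀ x, Integrable (fun ω => F x (G x ω)) μ) (hFh : ∀ x, ∫ ω, F x (G x ω) ∂μ ≤ h x)
    (hh : Integrable (fun ω => h (X ω)) μ) :
    Integrable (fun ω => F (X ω) (G (X ω) ω)) μ ∧
      ∫ ω, F (X ω) (G (X ω) ω) ∂μ ≤ ∫ ω, h (X ω) ∂μ := by
  have hX₀ : Measurable X := hX.mono hm le_rfl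
  have hh0 : ∀ x, 0 ≤ h x := fun x => (integral_nonneg fun ω => hF0 x _).trans (hFh x)
  have key : ∫⁻ ω, ENNReal.ofReal (F (X ω) (G (X ω) ω)) ∂μ ≤
      ∫⁻ ω, ENNReal.ofReal (h (X ω)) ∂μ := by
    rw [lintegral_comp_eq_tsum hm hX hG hind (fun x y => ENNReal.ofReal (F x y)),
      lintegral_comp_eq_tsum hm hX hG hind (fun x _ => ENNReal.ofReal (h x))]
    refine ENNReal.tsum_le_tsum fun x => mul_le_mul_right ?_ _
    rw [← ofReal_integral_eq_lintegral_ofReal (hFi x) (ae_of_all _ fun ω => hF0 x _)]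
    simpa using ENNReal.ofReal_le_ofReal (hFh x)
  have hmeas : Measurable fun ω => F (X ω) (G (X ω) ω) :=
    (measurable_of_countable (fun p : E × E => F p.1 p.2)).comp (hX₀.prodMk hY)
  rw [← ofReal_integral_eq_lintegral_ofReal hh (ae_of_all _ fun ω => hh0 _)] at key
  have hint : Integrable (fun ω => F (X ω) (G (X ω) ω)) μ :=
    ⟨hmeas.aestronglyMeasurable, (hasFiniteIntegral_iff_ofReal
      (ae_of_all _ fun ω => hF0 _ _)).2 (key.trans_lt ENNReal.ofReal_lt_top)⟩
  refine ⟨hint, ?_⟩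
  rw [← ofReal_integral_eq_lintegral_ofReal hint (ae_of_all _ fun ω => hF0 _ _)] at key
  exact (ENNReal.ofReal_le_ofReal_iff (integral_nonneg fun ω => hh0 _)).1 key

/-- Orthogonality of a martingale difference to the past: on each fibre, `S` cut off to the fibre is
still `m`-measurable, hence independent of the centered variable `D x (G x ·)`. -/
lemma integral_mul_eq_zero_of_indep (hm : m ≤ m₀) (hX : Measurable[m] X)
    (hG : ∀ x, Measurable (G x))
    (hind : ∀ x, Indep m (MeasurableSpace.comap (G x) inferInstance) μ)
    {D : E → E → ℝ} (hD : ∀ x, ∫ ω, D x (G x ω) ∂μ = 0)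
    {S : Ω → ℝ} (hS : Measurable[m] S)
    (hint : Integrable (fun ω => S ω * D (X ω) (G (X ω) ω)) μ) :
    ∫ ω, S ω * D (X ω) (G (X ω) ω) ∂μ = 0 := by
  have hXm : ∀ x, MeasurableSet[m] (X ⁻¹' {x}) := fun x => hX (measurableSet_singleton x)
  have hX₀ : ∀ x, MeasurableSet (X ⁻¹' {x}) := fun x => hm _ (hXm x)
  have hu : (⋃ x, X ⁻¹' {x}) = Set.univ := by ext; simp
  rw [← setIntegral_univ, ← hu, integral_iUnion hX₀
    (fun x y hxy => Disjoint.preimage _ (by simpa using hxy)) hint.integrableOn]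
  refine (tsum_congr fun x => ?_).trans tsum_zero
  rw [setIntegral_congr_fun (g := fun ω => S ω * D x (G x ω)) (hX₀ x)
    (fun ω hω => by simp only [Set.mem_preimage, Set.mem_singleton_iff] at hω; simp [hω]),
    ← integral_indicator (hX₀ x)]
  have hSi : Measurable[m] ((X ⁻¹' {x}).indicator S) := hS.indicator (hXm x)
  have hI : IndepFun ((X ⁻¹' {x}).indicator S) (fun ω => D x (G x ω)) μ := by
    rw [IndepFun_iff_Indep]
    refine indep_of_indep_of_le_left (indep_of_indep_of_le_right (hind x) ?_) hSi.comap_le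
    exact ((measurable_of_countable (D x)).comp (comap_measurable (G x))).comap_le
  have := hI.integral_fun_mul_eq_mul_integral (hSi.mono hm le_rfl).aestronglyMeasurable
    ((measurable_of_countable (D x)).comp (hG x)).aestronglyMeasurable
  rw [hD, mul_zero] at this
  rw [← this]
  congr 1
  ext ω
  by_cases h : ω ∈ X ⁻¹' {x} <;> simp [h]

end Conditioning

/-! ### One step of the process: past, next generation, innovation. -/

noncomputable section

variable {Ω : Type*} [MeasurableSpace Ω]

/-- The standing assumptions on offspring and immigration: independence, identical distribution
of the offspring of each type and of the immigrants, and finite fourth moments. -/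
structure Regular (μ : Measure Ω) (ξ : ℕ → ℕ → Fin 2 → Ω → (Fin 2 → ℕ))
    (ε : ℕ → Ω → (Fin 2 → ℕ)) : Prop where
  meas_offspring : ∀ k j i, Measurable (ξ k j i)
  meas_immigration : ∀ k, Measurable (ε k)
  indep : iIndepFun (family ξ ε) μ
  ident_offspring : ∀ k j i, IdentDistrib (ξ k j i) (ξ 0 0 i) μ μ
  ident_immigration : ∀ k, IdentDistrib (ε k) (ε 0) μ μ
  memLp_offspring : ∀ i ℓ, MemLp (fun ω => (ξ 0 0 i ω ℓ : ℝ)) 4 μ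
  memLp_immigration : ∀ ℓ, MemLp (fun ω => (ε 0 ω ℓ : ℝ)) 4 μ

/-- The next generation if the current one is `x`. -/
def nextGen (ξ : ℕ → ℕ → Fin 2 → Ω → (Fin 2 → ℕ)) (ε : ℕ → Ω → (Fin 2 → ℕ)) (k : ℕ)
    (x : Fin 2 → ℕ) (ω : Ω) : Fin 2 → ℕ :=
  ∑ i : Fin 2, ∑ j ∈ Finset.range (x i), ξ k j i ω + ε k ω

/-- The indices of the random vectors that contribute to `nextGen ξ ε k x`. -/
def genIndices (k : ℕ) (x : Fin 2 → ℕ) : Finset ((ℕ × ℕ × Fin 2) ⊕ ℕ) :=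
  (((Finset.univ : Finset (Fin 2)).sigma fun i => Finset.range (x i)).map
    ⟨fun p => (k, p.2, p.1), by rintro ⟨a, b⟩ ⟨c, d⟩ h; simp_all⟩).disjSum {k}

/-- The generation of an individual; immigrants count with the generation before their own. -/
def genOf : (ℕ × ℕ × Fin 2) ⊕ ℕ → ℕ := Sum.elim (fun p => p.1) id

/-- The information about the generations before `k`. -/
abbrev past (ξ : ℕ → ℕ → Fin 2 → Ω → (Fin 2 → ℕ)) (ε : ℕ → Ω → (Fin 2 → ℕ)) (k : ℕ) :
    MeasurableSpace Ω :=
  ⨆ p ∈ {p | genOf p < k}, MeasurableSpace.comap (family ξ ε p) inferInstance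

/-- The mean of `⟨w, Y⟩`. -/
def meanAlong (μ : Measure Ω) (w : Fin 2 → ℝ) (Y : Ω → (Fin 2 → ℕ)) : ℝ :=
  ∫ ω, w ⬝ᵥ toReal (Y ω) ∂μ

/-- The variance of `⟨w, Y⟩`. -/
def varAlong (μ : Measure Ω) (w : Fin 2 → ℝ) (Y : Ω → (Fin 2 → ℕ)) : ℝ :=
  variance (fun ω => w ⬝ᵥ toReal (Y ω)) μ

/-- The centered version of `⟨w, Y⟩`. -/
def centered (μ : Measure Ω) (w : Fin 2 → ℝ) (Y : Ω → (Fin 2 → ℕ)) (ω : Ω) : ℝ :=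
  w ⬝ᵥ toReal (Y ω) - meanAlong μ w Y

/-- `⟨w, y⟩` minus the conditional mean of `⟨w, X_{k+1}⟩` given `X_k = x`. -/
def innovation (μ : Measure Ω) (ξ : ℕ → ℕ → Fin 2 → Ω → (Fin 2 → ℕ)) (ε : ℕ → Ω → (Fin 2 → ℕ))
    (w : Fin 2 → ℝ) (x y : Fin 2 → ℕ) : ℝ :=
  w ⬝ᵥ toReal y - (∑ i, x i * meanAlong μ w (ξ 0 0 i) + meanAlong μ w (ε 0))

/-- The conditional variance of `⟨w, X_{k+1}⟩` given `X_k = x`. -/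
def condVar (μ : Measure Ω) (ξ : ℕ → ℕ → Fin 2 → Ω → (Fin 2 → ℕ)) (ε : ℕ → Ω → (Fin 2 → ℕ))
    (w : Fin 2 → ℝ) (x : Fin 2 → ℕ) : ℝ :=
  ∑ i, x i * varAlong μ w (ξ 0 0 i) + varAlong μ w (ε 0)

lemma sum_genIndices {M : Type*} [AddCommMonoid M] (f : (ℕ × ℕ × Fin 2) ⊕ ℕ → M) (k : ℕ)
    (x : Fin 2 → ℕ) : ∑ p ∈ genIndices k x, f p =
      ∑ i : Fin 2, ∑ j ∈ Finset.range (x i), f (Sum.inl (k, j, i)) + f (Sum.inr k) := by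
  rw [genIndices, Finset.sum_disjSum, Finset.sum_map, Finset.sum_sigma, Finset.sum_singleton]
  rfl

lemma card_genIndices (k : ℕ) (x : Fin 2 → ℕ) :
    ((genIndices k x).card : ℝ) = x 0 + x 1 + 1 := by
  rw [Finset.card_eq_sum_ones, sum_genIndices]
  simp [Fin.sum_univ_two]

lemma genOf_of_mem_genIndices {k : ℕ} {x : Fin 2 → ℕ} {p : (ℕ × ℕ × Fin 2) ⊕ ℕ}
    (hp : p ∈ genIndices k x) : genOf p = k := by
  rcases p with p | p
  · simp only [genIndices, Finset.inl_mem_disjSum, Finset.mem_map] at hp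
    obtain ⟨q, -, rfl⟩ := hp
    rfl
  · simpa [genIndices, genOf] using hp

lemma toReal_sum {ι : Type*} (s : Finset ι) (f : ι → Fin 2 → ℕ) :
    toReal (∑ i ∈ s, f i) = ∑ i ∈ s, toReal (f i) := by
  ext i; simp [toReal]

lemma dotProduct_toReal (w : Fin 2 → ℝ) (y : Fin 2 → ℕ) :
    w ⬝ᵥ toReal y = w 0 * y 0 + w 1 * y 1 := by
  simp [dotProduct, toReal, Fin.sum_univ_two]

section

variable {Ω : Type*} {ξ : ℕ → ℕ → Fin 2 → Ω → (Fin 2 → ℕ)} {ε : ℕ → Ω → (Fin 2 → ℕ)}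

lemma nextGen_eq_sum (k : ℕ) (x : Fin 2 → ℕ) (ω : Ω) :
    nextGen ξ ε k x ω = ∑ p ∈ genIndices k x, family ξ ε p ω := by
  rw [sum_genIndices]; rfl

lemma process_succ (k : ℕ) (ω : Ω) :
    process ξ ε (k + 1) ω = nextGen ξ ε k (process ξ ε k ω) ω := rfl

lemma measurable_along (w : Fin 2 → ℝ) : Measurable fun y : Fin 2 → ℕ => w ⬝ᵥ toReal y :=
  measurable_of_countable _

lemma past_mono {k l : ℕ} (h : k ≤ l) : past ξ ε k ≤ past ξ ε l :=
  biSup_mono fun _ hp => lt_of_lt_of_le hp h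

lemma measurable_family_past {p : (ℕ × ℕ × Fin 2) ⊕ ℕ} {k : ℕ} (hp : genOf p < k) :
    Measurable[past ξ ε k] (family ξ ε p) :=
  measurable_iff_comap_le.2
    (le_biSup (fun p => MeasurableSpace.comap (family ξ ε p) inferInstance) hp)

lemma measurable_nextGen_past (k : ℕ) (x : Fin 2 → ℕ) :
    Measurable[past ξ ε (k + 1)] (nextGen ξ ε k x) := by
  have : nextGen ξ ε k x = fun ω => ∑ p ∈ genIndices k x, family ξ ε p ω :=
    funext fun ω => nextGen_eq_sum k x ω
  rw [this]
  exact Finset.measurable_fun_sum _ fun p hp => measurable_family_past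
    ((genOf_of_mem_genIndices hp).trans_lt k.lt_succ_self)

/-- The number of summands in a generation is random, so preimages are split over the countably many
values of the previous generation. -/
lemma measurable_process_past (k : ℕ) : Measurable[past ξ ε k] (process ξ ε k) := by
  induction k with
  | zero => exact measurable_const
  | succ k ih =>
    have h1 : Measurable[past ξ ε (k + 1)] (process ξ ε k) := ih.mono (past_mono k.le_succ) le_rfl
    intro s hs
    have hu : process ξ ε (k + 1) ⁻¹' s =
        ⋃ x, process ξ ε k ⁻¹' {x} ∩ nextGen ξ ε k x ⁻¹' s := by
      ext ω; simp [process_succ]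
    rw [hu]
    exact MeasurableSet.iUnion fun x => MeasurableSet.inter (h1 (measurableSet_singleton x))
      (measurable_nextGen_past k x hs)

end

variable {μ : Measure Ω} {ξ : ℕ → ℕ → Fin 2 → Ω → (Fin 2 → ℕ)} {ε : ℕ → Ω → (Fin 2 → ℕ)}

namespace Regular

variable (h : Regular μ ξ ε)
include h

lemma measurable_family (p : (ℕ × ℕ × Fin 2) ⊕ ℕ) : Measurable (family ξ ε p) := by
  rcases p with p | p
  · exact h.meas_offspring _ _ _
  · exact h.meas_immigration _

lemma past_le (k : ℕ) : past ξ ε k ≤ ‹MeasurableSpace Ω› :=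
  iSup₂_le fun p _ => (h.measurable_family p).comap_le

lemma measurable_nextGen (k : ℕ) (x : Fin 2 → ℕ) : Measurable (nextGen ξ ε k x) :=
  (measurable_nextGen_past k x).mono (h.past_le _) le_rfl

lemma measurable_process (k : ℕ) : Measurable (process ξ ε k) :=
  (measurable_process_past k).mono (h.past_le _) le_rfl

/-- `past` and `nextGen` are built from members of the family with disjoint index sets, `genOf p <
k` and `genOf p = k`. -/
lemma indep_past_nextGen (k : ℕ) (x : Fin 2 → ℕ) :
    Indep (past ξ ε k) (MeasurableSpace.comap (nextGen ξ ε k x) inferInstance) μ := by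
  have hd : Disjoint {p : (ℕ × ℕ × Fin 2) ⊕ ℕ | genOf p < k} {p | genOf p = k} :=
    Set.disjoint_left.2 fun p hp hp' => (ne_of_lt hp) hp'
  have := indep_iSup_of_disjoint (fun p => (h.measurable_family p).comap_le)
    h.indep.iIndep hd
  refine indep_of_indep_of_le_right this (measurable_iff_comap_le.1 ?_)
  have hsum : nextGen ξ ε k x = fun ω => ∑ p ∈ genIndices k x, family ξ ε p ω :=
    funext fun ω => nextGen_eq_sum k x ω
  rw [hsum]
  refine Finset.measurable_fun_sum _ fun p hp => measurable_iff_comap_le.2 ?_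
  exact le_biSup (fun p => MeasurableSpace.comap (family ξ ε p) inferInstance)
    (genOf_of_mem_genIndices hp : p ∈ {p | genOf p = k})

lemma memLp_along_offspring (w : Fin 2 → ℝ) (i : Fin 2) :
    MemLp (fun ω => w ⬝ᵥ toReal (ξ 0 0 i ω)) 4 μ := by
  simp_rw [dotProduct_toReal]
  exact ((h.memLp_offspring i 0).const_mul _).add ((h.memLp_offspring i 1).const_mul _)

lemma memLp_along_immigration (w : Fin 2 → ℝ) :
    MemLp (fun ω => w ⬝ᵥ toReal (ε 0 ω)) 4 μ := by
  simp_rw [dotProduct_toReal]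
  exact ((h.memLp_immigration 0).const_mul _).add ((h.memLp_immigration 1).const_mul _)

lemma meanAlong_offspring (w : Fin 2 → ℝ) (k j : ℕ) (i : Fin 2) :
    meanAlong μ w (ξ k j i) = meanAlong μ w (ξ 0 0 i) :=
  ((h.ident_offspring k j i).comp (measurable_along w)).integral_eq

lemma meanAlong_immigration (w : Fin 2 → ℝ) (k : ℕ) :
    meanAlong μ w (ε k) = meanAlong μ w (ε 0) :=
  ((h.ident_immigration k).comp (measurable_along w)).integral_eq

lemma identDistrib_centered_offspring (w : Fin 2 → ℝ) (k j : ℕ) (i : Fin 2) :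
    IdentDistrib (centered μ w (ξ k j i)) (centered μ w (ξ 0 0 i)) μ μ := by
  have := (h.ident_offspring k j i).comp
    ((measurable_along w).sub_const (meanAlong μ w (ξ 0 0 i)))
  convert this using 1 <;> ext ω <;> simp [centered, h.meanAlong_offspring w k j i]

lemma identDistrib_centered_immigration (w : Fin 2 → ℝ) (k : ℕ) :
    IdentDistrib (centered μ w (ε k)) (centered μ w (ε 0)) μ μ := by
  have := (h.ident_immigration k).comp
    ((measurable_along w).sub_const (meanAlong μ w (ε 0)))
  convert this using 1 <;> ext ω <;> simp [centered, h.meanAlong_immigration w k]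

lemma measurable_centered (w : Fin 2 → ℝ) (p : (ℕ × ℕ × Fin 2) ⊕ ℕ) :
    Measurable (centered μ w (family ξ ε p)) :=
  ((measurable_along w).comp (h.measurable_family p)).sub_const _

lemma iIndepFun_centered (w : Fin 2 → ℝ) :
    iIndepFun (fun p => centered μ w (family ξ ε p)) μ :=
  h.indep.comp (fun p y => w ⬝ᵥ toReal y - meanAlong μ w (family ξ ε p))
    fun _ => measurable_of_countable _

/-- For fixed `x` the innovation is a sum of independent centered variables, which brings the moment
bounds for such sums into play. -/
lemma innovation_nextGen (w : Fin 2 → ℝ) (k : ℕ) (x : Fin 2 → ℕ) (ω : Ω) :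
    innovation μ ξ ε w x (nextGen ξ ε k x ω) =
      ∑ p ∈ genIndices k x, centered μ w (family ξ ε p) ω := by
  have hm : ∑ p ∈ genIndices k x, meanAlong μ w (family ξ ε p) =
      ∑ i, x i * meanAlong μ w (ξ 0 0 i) + meanAlong μ w (ε 0) := by
    rw [sum_genIndices]
    simp [family, h.meanAlong_offspring w k, h.meanAlong_immigration w k]
  rw [innovation, ← hm, nextGen_eq_sum, toReal_sum, dotProduct_sum, ← Finset.sum_sub_distrib]
  rfl

lemma integral_centered_sq_offspring (w : Fin 2 → ℝ) (k j : ℕ) (i : Fin 2) :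
    ∫ ω, centered μ w (ξ k j i) ω ^ 2 ∂μ = varAlong μ w (ξ 0 0 i) := by
  rw [varAlong, variance_eq_integral (h.memLp_along_offspring w i).1.aemeasurable]
  exact ((h.identDistrib_centered_offspring w k j i).comp
    (measurable_id.pow_const 2)).integral_eq

lemma integral_centered_sq_immigration (w : Fin 2 → ℝ) (k : ℕ) :
    ∫ ω, centered μ w (ε k) ω ^ 2 ∂μ = varAlong μ w (ε 0) := by
  rw [varAlong, variance_eq_integral (h.memLp_along_immigration w).1.aemeasurable]
  exact ((h.identDistrib_centered_immigration w k).comp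
    (measurable_id.pow_const 2)).integral_eq

/-- Only three laws occur in the family, two for offspring and one for immigrants; even moments are
nonnegative, so the sum of the three bounds each. -/
lemma exists_centered_moment_bound (w : Fin 2 → ℝ) : ∃ K : ℝ, 1 ≤ K ∧
    (∀ p, ∫ ω, centered μ w (family ξ ε p) ω ^ 2 ∂μ ≤ K) ∧
    (∀ p, ∫ ω, centered μ w (family ξ ε p) ω ^ 4 ∂μ ≤ K) := by
  have key : ∀ q : ℕ, Even q → ∃ K : ℝ, 0 ≤ K ∧
      ∀ p, ∫ ω, centered μ w (family ξ ε p) ω ^ q ∂μ ≤ K := by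
    intro q hq
    have hn : ∀ Y : Ω → Fin 2 → ℕ, 0 ≤ ∫ ω, centered μ w Y ω ^ q ∂μ :=
      fun Y => integral_nonneg fun ω => hq.pow_nonneg _
    refine ⟨(∫ ω, centered μ w (ξ 0 0 0) ω ^ q ∂μ) + (∫ ω, centered μ w (ξ 0 0 1) ω ^ q ∂μ)
      + ∫ ω, centered μ w (ε 0) ω ^ q ∂μ, by linarith [hn (ξ 0 0 0), hn (ξ 0 0 1), hn (ε 0)], ?_⟩
    rintro (⟨k, j, i⟩ | k)
    · have := ((h.identDistrib_centered_offspring w k j i).comp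
        (measurable_id.pow_const q)).integral_eq
      change ∫ ω, centered μ w (ξ k j i) ω ^ q ∂μ = ∫ ω, centered μ w (ξ 0 0 i) ω ^ q ∂μ at this
      change ∫ ω, centered μ w (ξ k j i) ω ^ q ∂μ ≤ _
      rw [this]
      fin_cases i
      · simp only [Fin.zero_eta]; linarith [hn (ξ 0 0 1), hn (ε 0)]
      · simp only [Fin.mk_one]; linarith [hn (ξ 0 0 0), hn (ε 0)]
    · have := ((h.identDistrib_centered_immigration w k).comp
        (measurable_id.pow_const q)).integral_eq
      change ∫ ω, centered μ w (ε k) ω ^ q ∂μ = ∫ ω, centered μ w (ε 0) ω ^ q ∂μ at this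
      change ∫ ω, centered μ w (ε k) ω ^ q ∂μ ≤ _
      rw [this]
      linarith [hn (ξ 0 0 0), hn (ξ 0 0 1)]
  obtain ⟨K₂, h2, hK₂⟩ := key 2 (by decide)
  obtain ⟨K₄, h4, hK₄⟩ := key 4 (by decide)
  exact ⟨1 + K₂ + K₄, by linarith, fun p => by linarith [hK₂ p], fun p => by linarith [hK₄ p]⟩

variable [IsProbabilityMeasure μ]

lemma memLp_centered (w : Fin 2 → ℝ) (p : (ℕ × ℕ × Fin 2) ⊕ ℕ) :
    MemLp (centered μ w (family ξ ε p)) 4 μ := by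
  rcases p with ⟨k, j, i⟩ | k
  · exact (h.identDistrib_centered_offspring w k j i).symm.memLp_snd
      ((h.memLp_along_offspring w i).sub (memLp_const _))
  · exact (h.identDistrib_centered_immigration w k).symm.memLp_snd
      ((h.memLp_along_immigration w).sub (memLp_const _))

lemma integral_centered (w : Fin 2 → ℝ) (p : (ℕ × ℕ × Fin 2) ⊕ ℕ) :
    ∫ ω, centered μ w (family ξ ε p) ω ∂μ = 0 := by
  have h1 : Integrable (fun ω => w ⬝ᵥ toReal (family ξ ε p ω)) μ := by
    have := ((h.memLp_centered w p).add
      (memLp_const (meanAlong μ w (family ξ ε p)))).integrable (by norm_num)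
    refine this.congr (ae_of_all _ fun ω => ?_)
    simp [centered]
  simp only [centered]
  rw [integral_sub h1 (integrable_const _)]
  simp [meanAlong]

lemma memLp_innovation (w : Fin 2 → ℝ) (k : ℕ) (x : Fin 2 → ℕ) :
    MemLp (fun ω => innovation μ ξ ε w x (nextGen ξ ε k x ω)) 4 μ := by
  simp_rw [h.innovation_nextGen]
  exact memLp_finsetSum _ fun p _ => h.memLp_centered w p

lemma integral_innovation (w : Fin 2 → ℝ) (k : ℕ) (x : Fin 2 → ℕ) :
    ∫ ω, innovation μ ξ ε w x (nextGen ξ ε k x ω) ∂μ = 0 := by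
  simp_rw [h.innovation_nextGen]
  exact integral_sum_of_centered (h.memLp_centered w) (h.integral_centered w) _

lemma integral_innovation_sq (w : Fin 2 → ℝ) (k : ℕ) (x : Fin 2 → ℕ) :
    ∫ ω, innovation μ ξ ε w x (nextGen ξ ε k x ω) ^ 2 ∂μ = condVar μ ξ ε w x := by
  simp_rw [h.innovation_nextGen]
  rw [integral_sum_sq_of_centered (h.iIndepFun_centered w) (h.measurable_centered w)
    (h.memLp_centered w) (h.integral_centered w), sum_genIndices]
  simp [family, h.integral_centered_sq_offspring, h.integral_centered_sq_immigration, condVar]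

lemma condVar_nonneg (w : Fin 2 → ℝ) (x : Fin 2 → ℕ) : 0 ≤ condVar μ ξ ε w x := by
  rw [← h.integral_innovation_sq w 0 x]
  exact integral_nonneg fun ω => sq_nonneg _

lemma exists_innovation_bound (w : Fin 2 → ℝ) : ∃ K : ℝ, 1 ≤ K ∧
    (∀ x, condVar μ ξ ε w x ≤ K * (x 0 + x 1 + 1)) ∧
    (∀ k x, ∫ ω, innovation μ ξ ε w x (nextGen ξ ε k x ω) ^ 4 ∂μ ≤
      3 * K ^ 2 * ((x 0 : ℝ) + x 1 + 1) ^ 2) := by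
  obtain ⟨K, hK, h2, h4⟩ := h.exists_centered_moment_bound w
  refine ⟨K, hK, fun x => ?_, fun k x => ?_⟩
  · rw [← h.integral_innovation_sq w 0 x]
    simp_rw [h.innovation_nextGen]
    rw [integral_sum_sq_of_centered (h.iIndepFun_centered w) (h.measurable_centered w)
      (h.memLp_centered w) (h.integral_centered w), ← card_genIndices 0 x, mul_comm]
    simpa using Finset.sum_le_card_nsmul _ _ K fun p (_ : p ∈ genIndices 0 x) => h2 p
  · simp_rw [h.innovation_nextGen]
    rw [← card_genIndices k x]
    exact integral_sum_pow_four_le (h.iIndepFun_centered w) (h.measurable_centered w)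
      (h.memLp_centered w) (h.integral_centered w) hK h2 h4 _

/-- Moment bounds for one step of the process from bounds given the current generation. -/
lemma integrable_step (k : ℕ) {F : (Fin 2 → ℕ) → (Fin 2 → ℕ) → ℝ} {g : (Fin 2 → ℕ) → ℝ}
    (hF0 : ∀ x y, 0 ≤ F x y) (hFi : ∀ x, Integrable (fun ω => F x (nextGen ξ ε k x ω)) μ)
    (hFg : ∀ x, ∫ ω, F x (nextGen ξ ε k x ω) ∂μ ≤ g x)
    (hg : Integrable (fun ω => g (process ξ ε k ω)) μ) :
    Integrable (fun ω => F (process ξ ε k ω) (process ξ ε (k + 1) ω)) μ ∧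
      ∫ ω, F (process ξ ε k ω) (process ξ ε (k + 1) ω) ∂μ ≤ ∫ ω, g (process ξ ε k ω) ∂μ :=
  integrable_comp_and_integral_le (h.past_le k) (measurable_process_past k)
    (h.measurable_nextGen k) (h.measurable_process (k + 1)) (h.indep_past_nextGen k)
    hF0 hFi hFg hg

end Regular

end

/-! ### The critical process and its linear recursions. -/

noncomputable section

/-- The process is critical and its mean matrix has the eigenvalue `δ` for `(1, -1)`. -/
structure Critical {Ω : Type*} [MeasurableSpace Ω] (μ : Measure Ω)
    (ξ : ℕ → ℕ → Fin 2 → Ω → (Fin 2 → ℕ)) (ε : ℕ → Ω → (Fin 2 → ℕ)) (δ : ℝ) : Prop extends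
    Regular μ ξ ε where
  mean_oneVec : ∀ i, meanAlong μ oneVec (ξ 0 0 i) = 1
  mean_uTilde_zero : meanAlong μ uTilde (ξ 0 0 0) = δ
  mean_uTilde_one : meanAlong μ uTilde (ξ 0 0 1) = -δ
  abs_lt_one : |δ| < 1

/-- The martingale difference that arises from the decomposition of `V_{k+1}²`. -/
def sqDiff {Ω : Type*} [MeasurableSpace Ω] (μ : Measure Ω)
    (ξ : ℕ → ℕ → Fin 2 → Ω → (Fin 2 → ℕ)) (ε : ℕ → Ω → (Fin 2 → ℕ)) (δ : ℝ)
    (x y : Fin 2 → ℕ) : ℝ :=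
  2 * (δ * (uTilde ⬝ᵥ toReal x) + meanAlong μ uTilde (ε 0)) * innovation μ ξ ε uTilde x y
    + innovation μ ξ ε uTilde x y ^ 2 - condVar μ ξ ε uTilde x

lemma oneVec_dotProduct (y : Fin 2 → ℕ) : oneVec ⬝ᵥ toReal y = y 0 + y 1 := by
  rw [dotProduct_toReal]; simp [oneVec]

lemma uTilde_dotProduct (y : Fin 2 → ℕ) : uTilde ⬝ᵥ toReal y = y 0 - y 1 := by
  rw [dotProduct_toReal]; simp [uTilde, sub_eq_add_neg]

lemma oneVec_dotProduct_nonneg (y : Fin 2 → ℕ) : 0 ≤ oneVec ⬝ᵥ toReal y := by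
  rw [oneVec_dotProduct]; positivity

lemma measurable_comp_pair {Ω E : Type*} [Countable E] [MeasurableSpace E]
    [MeasurableSingletonClass E] {m : MeasurableSpace Ω} {X Y : Ω → E} (hX : Measurable X)
    (hY : Measurable Y) (F : E → E → ℝ) : Measurable fun ω => F (X ω) (Y ω) :=
  (measurable_of_countable fun p : E × E => F p.1 p.2).comp (hX.prodMk hY)

lemma U_eq {Ω : Type*} (ξ : ℕ → ℕ → Fin 2 → Ω → (Fin 2 → ℕ)) (ε : ℕ → Ω → (Fin 2 → ℕ)) (k : ℕ)
    (ω : Ω) : U ξ ε k ω = process ξ ε k ω 0 + process ξ ε k ω 1 :=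
  oneVec_dotProduct _

lemma V_eq {Ω : Type*} (ξ : ℕ → ℕ → Fin 2 → Ω → (Fin 2 → ℕ)) (ε : ℕ → Ω → (Fin 2 → ℕ)) (k : ℕ)
    (ω : Ω) : V ξ ε k ω = process ξ ε k ω 0 - process ξ ε k ω 1 :=
  uTilde_dotProduct _

lemma V_zero {Ω : Type*} (ξ : ℕ → ℕ → Fin 2 → Ω → (Fin 2 → ℕ)) (ε : ℕ → Ω → (Fin 2 → ℕ))
    (ω : Ω) : V ξ ε 0 ω = 0 := by
  simp [V_eq, process]

lemma add_pow_four_le (a b : ℝ) : (a + b) ^ 4 ≤ 8 * (a ^ 4 + b ^ 4) := by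
  nlinarith [sq_nonneg (a - b), sq_nonneg (a ^ 2 - b ^ 2), sq_nonneg (a + b),
    mul_nonneg (sq_nonneg (a - b)) (sq_nonneg (a + b)), sq_nonneg ((a - b) ^ 2),
    mul_nonneg (sq_nonneg (a - b)) (sq_nonneg a), mul_nonneg (sq_nonneg (a - b)) (sq_nonneg b)]

/-- Convexity of `t⁴` at the points `|a|` and `|b| / (1 - |δ|)` with weights `|δ|` and `1 - |δ|`.
The factor of `a⁴` stays below one, as the recursion for `E V_k⁴` needs. -/
lemma contraction_add_pow_four_le {δ : ℝ} (hδ : |δ| < 1) (a b : ℝ) :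
    (δ * a + b) ^ 4 ≤ |δ| * a ^ 4 + ((1 - |δ|) ^ 3)⁻¹ * b ^ 4 := by
  have h1 : 0 < 1 - |δ| := by linarith
  have hc := (Even.convexOn_pow (𝕜 := ℝ) (n := 4) (by decide)).2 (Set.mem_univ |a|)
    (Set.mem_univ (|b| / (1 - |δ|))) (abs_nonneg δ) h1.le (by ring)
  simp only [smul_eq_mul] at hc
  have h2 : (1 - |δ|) * (|b| / (1 - |δ|)) = |b| := by field_simp
  rw [h2] at hc
  have h3 : (δ * a + b) ^ 4 ≤ (|δ| * |a| + |b|) ^ 4 := by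
    rw [← (show Even 4 by decide).pow_abs]
    refine pow_le_pow_left₀ (abs_nonneg _) ((abs_add_le _ _).trans (by rw [abs_mul])) 4
  have e1 : |a| ^ 4 = a ^ 4 := (show Even 4 by decide).pow_abs a
  have e2 : |b| ^ 4 = b ^ 4 := (show Even 4 by decide).pow_abs b
  refine h3.trans (hc.trans (le_of_eq ?_))
  rw [div_pow, e1, e2]
  field_simp

variable {Ω : Type*} [MeasurableSpace Ω]
  {μ : Measure Ω} {ξ : ℕ → ℕ → Fin 2 → Ω → (Fin 2 → ℕ)} {ε : ℕ → Ω → (Fin 2 → ℕ)} {δ : ℝ}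

namespace Critical

variable (h : Critical μ ξ ε δ)
include h

lemma measurable_U (k : ℕ) : Measurable (U ξ ε k) :=
  (measurable_along oneVec).comp (h.measurable_process k)

lemma measurable_V (k : ℕ) : Measurable (V ξ ε k) :=
  (measurable_along uTilde).comp (h.measurable_process k)

lemma measurable_step (F : (Fin 2 → ℕ) → (Fin 2 → ℕ) → ℝ) (k : ℕ) :
    Measurable fun ω => F (process ξ ε k ω) (process ξ ε (k + 1) ω) :=
  measurable_comp_pair (h.measurable_process k) (h.measurable_process (k + 1)) F

lemma innovation_oneVec (x y : Fin 2 → ℕ) : innovation μ ξ ε oneVec x y =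
    oneVec ⬝ᵥ toReal y - (oneVec ⬝ᵥ toReal x + meanAlong μ oneVec (ε 0)) := by
  simp only [innovation, Fin.sum_univ_two, h.mean_oneVec, oneVec_dotProduct, mul_one]

lemma innovation_uTilde (x y : Fin 2 → ℕ) : innovation μ ξ ε uTilde x y =
    uTilde ⬝ᵥ toReal y - (δ * (uTilde ⬝ᵥ toReal x) + meanAlong μ uTilde (ε 0)) := by
  simp only [innovation, Fin.sum_univ_two, h.mean_uTilde_zero, h.mean_uTilde_one,
    uTilde_dotProduct]
  ring

lemma V_succ (k : ℕ) (ω : Ω) : V ξ ε (k + 1) ω = δ * V ξ ε k ω +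
    (innovation μ ξ ε uTilde (process ξ ε k ω) (process ξ ε (k + 1) ω)
      + meanAlong μ uTilde (ε 0)) := by
  rw [h.innovation_uTilde, V, V]; ring

/-! ### Growth of the moments of `U`, of the innovations and of `V`. -/

variable [IsProbabilityMeasure μ]

lemma integrable_U (k : ℕ) : Integrable (U ξ ε k) μ ∧
    ∫ ω, U ξ ε k ω ∂μ ≤ k * meanAlong μ oneVec (ε 0) := by
  induction k with
  | zero =>
    have : U ξ ε 0 = fun _ => 0 := by ext ω; simp [U_eq, process]
    simp [this]
  | succ k ih =>
    have e : ∀ x ω, oneVec ⬝ᵥ toReal (nextGen ξ ε k x ω) =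
        innovation μ ξ ε oneVec x (nextGen ξ ε k x ω) +
          (oneVec ⬝ᵥ toReal x + meanAlong μ oneVec (ε 0)) := by
      intro x ω; rw [h.innovation_oneVec]; ring
    have hi : ∀ x, Integrable (fun ω => innovation μ ξ ε oneVec x (nextGen ξ ε k x ω)) μ :=
      fun x => (h.memLp_innovation oneVec k x).integrable (by norm_num)
    have := h.integrable_step k (F := fun _ y => oneVec ⬝ᵥ toReal y)
      (g := fun x => oneVec ⬝ᵥ toReal x + meanAlong μ oneVec (ε 0))
      (fun _ y => oneVec_dotProduct_nonneg y)
      (fun x => by simp_rw [e]; exact (hi x).add (integrable_const _))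
      (fun x => by
        simp_rw [e]
        rw [integral_add (hi x) (integrable_const _), h.integral_innovation]
        simp)
      (ih.1.add (integrable_const _))
    refine ⟨this.1, this.2.trans ?_⟩
    rw [integral_add (show Integrable (fun ω => oneVec ⬝ᵥ toReal (process ξ ε k ω)) μ from ih.1)
      (integrable_const _)]
    have h2 : ∫ ω, oneVec ⬝ᵥ toReal (process ξ ε k ω) ∂μ ≤ k * meanAlong μ oneVec (ε 0) := ih.2
    simp only [integral_const, probReal_univ, one_smul]
    push_cast
    linarith

omit h [IsProbabilityMeasure μ] in
lemma meanAlong_oneVec_nonneg (Y : Ω → Fin 2 → ℕ) : 0 ≤ meanAlong μ oneVec Y :=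
  integral_nonneg fun _ => oneVec_dotProduct_nonneg _

lemma exists_integral_U_sq_le : ∃ C : ℝ, ∀ k : ℕ,
    Integrable (fun ω => (U ξ ε k ω + 1) ^ 2) μ ∧
      ∫ ω, (U ξ ε k ω + 1) ^ 2 ∂μ ≤ C * ((k : ℝ) + 1) ^ 2 := by
  obtain ⟨K, hK, hvar, -⟩ := h.exists_innovation_bound oneVec
  set m := meanAlong μ oneVec (ε 0) with hm
  have hm0 : 0 ≤ m := meanAlong_oneVec_nonneg _
  -- With `u = U_k`, the conditional second moment of `U_{k+1} + 1` is at most `K(u + 1) + (u + 1 +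
  -- m)²`, hence at most `(u + 1)² + A(u + 1)`.
  set A := K + 2 * m + m ^ 2 with hA
  have hA0 : 0 ≤ A := by positivity
  -- The `1` covers `k = 0`; each step adds at most `A(mk + 1) ≤ A(m + 1)(k + 1)`.
  refine ⟨1 + A * (m + 1), fun k => ?_⟩
  induction k with
  | zero =>
    have : U ξ ε 0 = fun _ => 0 := by ext ω; simp [U_eq, process]
    simp only [this]
    simp
    positivity
  | succ k ih =>
    have e : ∀ x ω, (oneVec ⬝ᵥ toReal (nextGen ξ ε k x ω) + 1) ^ 2 =
        innovation μ ξ ε oneVec x (nextGen ξ ε k x ω) ^ 2 +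
        2 * (oneVec ⬝ᵥ toReal x + m + 1) * innovation μ ξ ε oneVec x (nextGen ξ ε k x ω) +
          (oneVec ⬝ᵥ toReal x + m + 1) ^ 2 := by
      intro x ω; rw [h.innovation_oneVec]; ring
    have hi2 : ∀ x, Integrable (fun ω => innovation μ ξ ε oneVec x (nextGen ξ ε k x ω) ^ 2) μ :=
      fun x => integrable_pow_of_memLp_four (h.memLp_innovation oneVec k x) (by norm_num)
    have hi1 : ∀ x, Integrable (fun ω => 2 * (oneVec ⬝ᵥ toReal x + m + 1) *
        innovation μ ξ ε oneVec x (nextGen ξ ε k x ω)) μ :=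
      fun x => ((h.memLp_innovation oneVec k x).integrable (by norm_num)).const_mul _
    have hU : Integrable (fun ω => A * (U ξ ε k ω + 1)) μ :=
      (((h.integrable_U k).1).add (integrable_const 1)).const_mul A
    have := h.integrable_step k (F := fun _ y => (oneVec ⬝ᵥ toReal y + 1) ^ 2)
      (g := fun x => (oneVec ⬝ᵥ toReal x + 1) ^ 2 + A * (oneVec ⬝ᵥ toReal x + 1))
      (fun x y => sq_nonneg _)
      (fun x => by
        simp_rw [e]; exact ((hi2 x).add (hi1 x)).add (integrable_const _))
      (fun x => by
        simp_rw [e]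
        rw [integral_add ((hi2 x).fun_add (hi1 x)) (integrable_const _),
          integral_add (hi2 x) (hi1 x), integral_const_mul, h.integral_innovation,
          h.integral_innovation_sq]
        simp only [integral_const, probReal_univ, one_smul, mul_zero, add_zero]
        have h1 := hvar x
        rw [← oneVec_dotProduct] at h1
        have h3 := oneVec_dotProduct_nonneg x
        rw [hA]
        nlinarith [mul_nonneg (sq_nonneg m) h3])
      (ih.1.add hU)
    refine ⟨this.1, this.2.trans ?_⟩
    change ∫ ω, ((U ξ ε k ω + 1) ^ 2 + A * (U ξ ε k ω + 1)) ∂μ ≤ _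
    rw [integral_add ih.1 hU, integral_const_mul,
      integral_add (h.integrable_U k).1 (integrable_const _)]
    simp only [integral_const, probReal_univ, one_smul]
    have h1 := mul_le_mul_of_nonneg_left (h.integrable_U k).2 hA0
    have h2 := ih.2
    rw [← hm] at h1
    have hk : (0 : ℝ) ≤ k := k.cast_nonneg
    push_cast
    have h3 := mul_nonneg hA0 hm0
    have h4 := mul_nonneg h3 hk
    have h5 := mul_nonneg hA0 hk
    nlinarith

/-- Given `X_k`, the fourth moment is at most `3K²(U_k + 1)²`; the second moment of `U_k + 1`
finishes. -/
lemma exists_integral_innovation_pow_four_le (w : Fin 2 → ℝ) : ∃ C : ℝ, 0 ≤ C ∧ ∀ k : ℕ,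
    Integrable (fun ω => innovation μ ξ ε w (process ξ ε k ω) (process ξ ε (k + 1) ω) ^ 4) μ ∧
      ∫ ω, innovation μ ξ ε w (process ξ ε k ω) (process ξ ε (k + 1) ω) ^ 4 ∂μ ≤
        C * ((k : ℝ) + 1) ^ 2 := by
  obtain ⟨K, hK, -, h4⟩ := h.exists_innovation_bound w
  obtain ⟨C, hC⟩ := h.exists_integral_U_sq_le
  have hC0 : 0 ≤ C := by
    have := (integral_nonneg fun ω => sq_nonneg (U ξ ε 0 ω + 1)).trans (hC 0).2
    simpa using this
  refine ⟨3 * K ^ 2 * C, by positivity, fun k => ?_⟩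
  have hg : Integrable (fun ω => 3 * K ^ 2 *
      ((process ξ ε k ω 0 : ℝ) + process ξ ε k ω 1 + 1) ^ 2) μ := by
    simpa only [U_eq] using (hC k).1.const_mul (3 * K ^ 2)
  have := h.integrable_step k (F := fun x y => innovation μ ξ ε w x y ^ 4)
    (g := fun x => 3 * K ^ 2 * ((x 0 : ℝ) + x 1 + 1) ^ 2) (fun x y => by positivity)
    (fun x => integrable_pow_of_memLp_four (h.memLp_innovation w k x) le_rfl) (h4 k) hg
  refine ⟨this.1, this.2.trans ?_⟩
  rw [integral_const_mul, mul_assoc (3 * K ^ 2)]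
  have h2 := (hC k).2
  simp only [U_eq] at h2
  exact mul_le_mul_of_nonneg_left h2 (by positivity)

lemma exists_integral_V_pow_four_le : ∃ C : ℝ, 0 ≤ C ∧ ∀ k : ℕ,
    Integrable (fun ω => V ξ ε k ω ^ 4) μ ∧
      ∫ ω, V ξ ε k ω ^ 4 ∂μ ≤ C * ((k : ℝ) + 1) ^ 2 := by
  obtain ⟨B, hB0, hB⟩ := h.exists_integral_innovation_pow_four_le uTilde
  set m := meanAlong μ uTilde (ε 0) with hm
  have hδ : 0 < 1 - |δ| := by linarith [h.abs_lt_one]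
  set A := ((1 - |δ|) ^ 3)⁻¹ * (8 * (B + m ^ 4)) with hA
  have hA0 : 0 ≤ A := by positivity
  -- The fixed point of `c = |δ| c + A`, which is what the recursion for `E V_k⁴ / (k + 1)²`
  -- requires.
  refine ⟨A / (1 - |δ|), by positivity, fun k => ?_⟩
  induction k with
  | zero => simp [V_zero]; positivity
  | succ k ih =>
    have hle : ∀ ω, V ξ ε (k + 1) ω ^ 4 ≤ |δ| * V ξ ε k ω ^ 4 + ((1 - |δ|) ^ 3)⁻¹ *
        (8 * (innovation μ ξ ε uTilde (process ξ ε k ω) (process ξ ε (k + 1) ω) ^ 4 + m ^ 4)) := by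
      intro ω
      rw [h.V_succ]
      refine (contraction_add_pow_four_le h.abs_lt_one _ _).trans ?_
      gcongr
      exact add_pow_four_le _ _
    have i1 := ih.1.const_mul |δ|
    have i2 := (((hB k).1.fun_add (integrable_const (m ^ 4))).const_mul 8).const_mul
      ((1 - |δ|) ^ 3)⁻¹
    have hi : Integrable (fun ω => V ξ ε (k + 1) ω ^ 4) μ :=
      (i1.add i2).mono' ((h.measurable_V _).pow_const 4).aestronglyMeasurable
        (ae_of_all _ fun ω => by
          rw [Real.norm_of_nonneg (by positivity)]; exact hle ω)
    refine ⟨hi, (integral_mono hi (i1.add i2) hle).trans ?_⟩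
    simp only [Pi.add_apply]
    rw [integral_add i1 i2, integral_const_mul, integral_const_mul, integral_const_mul,
      integral_add (hB k).1 (integrable_const _)]
    simp only [integral_const, probReal_univ, one_smul]
    have hk : (0 : ℝ) ≤ k := k.cast_nonneg
    have hm4 : m ^ 4 ≤ m ^ 4 * ((k : ℝ) + 1) ^ 2 :=
      le_mul_of_one_le_right (by positivity) (by nlinarith)
    calc _ ≤ |δ| * (A / (1 - |δ|) * ((k : ℝ) + 1) ^ 2) + ((1 - |δ|) ^ 3)⁻¹ *
          (8 * (B * ((k : ℝ) + 1) ^ 2 + m ^ 4 * ((k : ℝ) + 1) ^ 2)) := by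
            gcongr
            · exact ih.2
            · exact (hB k).2
      _ = A / (1 - |δ|) * ((k : ℝ) + 1) ^ 2 := by
            rw [hA]; field_simp; ring
      _ ≤ _ := by
            push_cast
            gcongr
            linarith

/-! ### The martingale part and the second moment of the remainder. -/

lemma integral_sqDiff_nextGen (k : ℕ) (x : Fin 2 → ℕ) :
    ∫ ω, sqDiff μ ξ ε δ x (nextGen ξ ε k x ω) ∂μ = 0 := by
  have i1 := ((h.memLp_innovation uTilde k x).integrable (by norm_num)).const_mul
    (2 * (δ * (uTilde ⬝ᵥ toReal x) + meanAlong μ uTilde (ε 0)))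
  have i2 : Integrable (fun ω => innovation μ ξ ε uTilde x (nextGen ξ ε k x ω) ^ 2) μ :=
    integrable_pow_of_memLp_four (h.memLp_innovation uTilde k x) (by norm_num)
  simp only [sqDiff]
  rw [integral_sub (i1.fun_add i2) (integrable_const _), integral_add i1 i2, integral_const_mul,
    h.integral_innovation, h.integral_innovation_sq]
  simp

lemma exists_integral_sqDiff_sq_le : ∃ C : ℝ, 0 ≤ C ∧ ∀ k : ℕ,
    Integrable (fun ω => sqDiff μ ξ ε δ (process ξ ε k ω) (process ξ ε (k + 1) ω) ^ 2) μ ∧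
      ∫ ω, sqDiff μ ξ ε δ (process ξ ε k ω) (process ξ ε (k + 1) ω) ^ 2 ∂μ ≤
        C * ((k : ℝ) + 1) ^ 2 := by
  obtain ⟨B, hB0, hB⟩ := h.exists_integral_innovation_pow_four_le uTilde
  obtain ⟨A, hA0, hA⟩ := h.exists_integral_V_pow_four_le
  obtain ⟨C, hC⟩ := h.exists_integral_U_sq_le
  obtain ⟨K, hK, hvar, -⟩ := h.exists_innovation_bound uTilde
  have hC0 : 0 ≤ C := by
    have := (integral_nonneg fun ω => sq_nonneg (U ξ ε 0 ω + 1)).trans (hC 0).2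
    simpa using this
  set m := meanAlong μ uTilde (ε 0) with hm
  -- With `a = δV + m`: the square of three terms costs a factor `3`, `(2an)² ≤ 2(a⁴ + n⁴)` and `a⁴
  -- ≤ 8(V⁴ + m⁴)`. Hence `48 = 3·2·8` and `9 = 3·(2 + 1)`.
  refine ⟨48 * A + 48 * m ^ 4 + 9 * B + 3 * K ^ 2 * C, by positivity, fun k => ?_⟩
  have hle : ∀ ω, sqDiff μ ξ ε δ (process ξ ε k ω) (process ξ ε (k + 1) ω) ^ 2 ≤
      48 * V ξ ε k ω ^ 4 + 48 * m ^ 4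
      + 9 * innovation μ ξ ε uTilde (process ξ ε k ω) (process ξ ε (k + 1) ω) ^ 4
      + 3 * K ^ 2 * (U ξ ε k ω + 1) ^ 2 := by
    intro ω
    have h1 := hvar (process ξ ε k ω)
    have h0 := h.condVar_nonneg uTilde (process ξ ε k ω)
    rw [← U_eq] at h1
    simp only [sqDiff]
    rw [← hm, ← V]
    set n := innovation μ ξ ε uTilde (process ξ ε k ω) (process ξ ε (k + 1) ω)
    set v := V ξ ε k ω
    set q := condVar μ ξ ε uTilde (process ξ ε k ω)
    have hq : q ^ 2 ≤ K ^ 2 * (U ξ ε k ω + 1) ^ 2 := by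
      rw [← mul_pow]; exact pow_le_pow_left₀ h0 h1 2
    have hp : (δ * v + m) ^ 4 ≤ 8 * (v ^ 4 + m ^ 4) := by
      refine (add_pow_four_le _ _).trans ?_
      have : (δ * v) ^ 4 ≤ v ^ 4 := by
        rw [mul_pow]
        refine mul_le_of_le_one_left (by positivity) ?_
        rw [← (show Even 4 by decide).pow_abs]
        exact pow_le_one₀ (abs_nonneg _) h.abs_lt_one.le
      linarith
    set a := δ * v + m
    have h3 : (2 * a * n + n ^ 2 - q) ^ 2 ≤ 3 * ((2 * a * n) ^ 2 + (n ^ 2) ^ 2 + q ^ 2) := by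
      nlinarith [sq_nonneg (2 * a * n - n ^ 2), sq_nonneg (2 * a * n + q), sq_nonneg (n ^ 2 + q)]
    have h4 : (2 * a * n) ^ 2 ≤ 2 * (a ^ 4 + n ^ 4) := by
      nlinarith [sq_nonneg (a ^ 2 - n ^ 2)]
    have h5 : (n ^ 2) ^ 2 = n ^ 4 := by ring
    linarith
  have i1 := (hA k).1.const_mul 48
  have i2 : Integrable (fun _ : Ω => 48 * m ^ 4) μ := integrable_const _
  have i3 := (hB k).1.const_mul 9
  have i4 := (hC k).1.const_mul (3 * K ^ 2)
  have hR := ((i1.fun_add i2).fun_add i3).fun_add i4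
  have hi : Integrable
      (fun ω => sqDiff μ ξ ε δ (process ξ ε k ω) (process ξ ε (k + 1) ω) ^ 2) μ :=
    hR.mono' ((h.measurable_step (sqDiff μ ξ ε δ) k).pow_const 2).aestronglyMeasurable
      (ae_of_all _ fun ω => by rw [Real.norm_of_nonneg (sq_nonneg _)]; exact hle ω)
  refine ⟨hi, (integral_mono hi hR hle).trans ?_⟩
  rw [integral_add ((i1.fun_add i2).fun_add i3) i4, integral_add (i1.fun_add i2) i3,
    integral_add i1 i2]
  simp only [integral_const_mul, integral_const, probReal_univ, one_smul]
  have hk : (0 : ℝ) ≤ k := k.cast_nonneg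
  have hm4 : m ^ 4 ≤ m ^ 4 * ((k : ℝ) + 1) ^ 2 :=
    le_mul_of_one_le_right (by positivity) (by nlinarith)
  have h4 := mul_le_mul_of_nonneg_left (hC k).2 (show 0 ≤ 3 * K ^ 2 by positivity)
  linarith [(hA k).2, (hB k).2]

/-- Second moments of orthogonal terms add up, giving `n` terms of order `n²`. Cauchy–Schwarz alone
would give order `n⁴`, which is not enough. -/
lemma exists_integral_sum_sqDiff_sq_le : ∃ C : ℝ, 0 ≤ C ∧ ∀ n : ℕ,
    Integrable (fun ω => (∑ k ∈ Finset.range n,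
      sqDiff μ ξ ε δ (process ξ ε k ω) (process ξ ε (k + 1) ω)) ^ 2) μ ∧
      ∫ ω, (∑ k ∈ Finset.range n,
        sqDiff μ ξ ε δ (process ξ ε k ω) (process ξ ε (k + 1) ω)) ^ 2 ∂μ ≤
        C * ((n : ℝ) + 1) ^ 3 := by
  obtain ⟨C, hC0, hC⟩ := h.exists_integral_sqDiff_sq_le
  have hD : ∀ k, MemLp
      (fun ω => sqDiff μ ξ ε δ (process ξ ε k ω) (process ξ ε (k + 1) ω)) 2 μ := fun k =>
    (memLp_two_iff_integrable_sq (h.measurable_step _ k).aestronglyMeasurable).2 (hC k).1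
  have hM : ∀ n, MemLp (fun ω => ∑ k ∈ Finset.range n,
      sqDiff μ ξ ε δ (process ξ ε k ω) (process ξ ε (k + 1) ω)) 2 μ := fun n =>
    memLp_finsetSum _ fun k _ => hD k
  have hpast : ∀ n, Measurable[past ξ ε n] fun ω => ∑ k ∈ Finset.range n,
      sqDiff μ ξ ε δ (process ξ ε k ω) (process ξ ε (k + 1) ω) := by
    intro n
    refine Finset.measurable_fun_sum _ fun k hk => ?_
    have hk' : k + 1 ≤ n := Finset.mem_range.1 hk
    exact measurable_comp_pair
      ((measurable_process_past k).mono (past_mono (by lia)) le_rfl)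
      ((measurable_process_past (k + 1)).mono (past_mono hk') le_rfl) (sqDiff μ ξ ε δ)
  refine ⟨C, hC0, fun n => ⟨(hM n).integrable_sq, ?_⟩⟩
  induction n with
  | zero => simpa using hC0
  | succ n ih =>
    have i2 := (hM n).integrable_mul (hD n)
    -- The partial sum depends only on the past of generation `n`, and the next term is centered
    -- given `X_n`.
    have horth := integral_mul_eq_zero_of_indep (h.past_le n) (measurable_process_past n)
      (h.measurable_nextGen n) (h.indep_past_nextGen n) (h.integral_sqDiff_nextGen n)
      (hpast n) i2
    simp_rw [← process_succ] at horth
    have hexp : ∀ ω, (∑ k ∈ Finset.range (n + 1),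
        sqDiff μ ξ ε δ (process ξ ε k ω) (process ξ ε (k + 1) ω)) ^ 2 =
        (∑ k ∈ Finset.range n,
          sqDiff μ ξ ε δ (process ξ ε k ω) (process ξ ε (k + 1) ω)) ^ 2
        + 2 * ((∑ k ∈ Finset.range n,
          sqDiff μ ξ ε δ (process ξ ε k ω) (process ξ ε (k + 1) ω))
            * sqDiff μ ξ ε δ (process ξ ε n ω) (process ξ ε (n + 1) ω))
        + sqDiff μ ξ ε δ (process ξ ε n ω) (process ξ ε (n + 1) ω) ^ 2 := by
      intro ω; rw [Finset.sum_range_succ]; ring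
    have i2' : Integrable (fun ω => 2 * ((∑ k ∈ Finset.range n,
          sqDiff μ ξ ε δ (process ξ ε k ω) (process ξ ε (k + 1) ω))
            * sqDiff μ ξ ε δ (process ξ ε n ω) (process ξ ε (n + 1) ω))) μ := i2.const_mul 2
    simp_rw [hexp]
    rw [integral_add ((hM n).integrable_sq.fun_add i2') (hC n).1,
      integral_add (hM n).integrable_sq i2', integral_const_mul, horth]
    have h1 := (hC n).2
    have hn : (0 : ℝ) ≤ n := n.cast_nonneg
    push_cast
    have : C * ((n : ℝ) + 1) ^ 3 + C * ((n : ℝ) + 1) ^ 2 ≤ C * ((n : ℝ) + 1 + 1) ^ 3 := by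
      rw [← mul_add]
      refine mul_le_mul_of_nonneg_left ?_ hC0
      nlinarith [mul_nonneg hn hn]
    linarith

/-- Instead of Jensen's inequality, `V² ≤ t + V⁴ / t` with `t = k + 1`. -/
lemma exists_integral_V_sq_le : ∃ C : ℝ, 0 ≤ C ∧ ∀ k : ℕ,
    Integrable (fun ω => V ξ ε k ω ^ 2) μ ∧
      ∫ ω, V ξ ε k ω ^ 2 ∂μ ≤ C * ((k : ℝ) + 1) := by
  obtain ⟨A, hA0, hA⟩ := h.exists_integral_V_pow_four_le
  refine ⟨1 + A, by positivity, fun k => ?_⟩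
  have hk : (0 : ℝ) < (k : ℝ) + 1 := by positivity
  have hle : ∀ ω, V ξ ε k ω ^ 2 ≤ ((k : ℝ) + 1) + ((k : ℝ) + 1)⁻¹ * V ξ ε k ω ^ 4 := by
    intro ω
    rw [← sub_nonneg]
    have : ((k : ℝ) + 1) + ((k : ℝ) + 1)⁻¹ * V ξ ε k ω ^ 4 - V ξ ε k ω ^ 2 =
        ((k : ℝ) + 1)⁻¹ * ((((k : ℝ) + 1) - V ξ ε k ω ^ 2 / 2) ^ 2
          + 3 / 4 * V ξ ε k ω ^ 4) := by
      field_simp; ring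
    rw [this]; positivity
  have hR := (integrable_const (μ := μ) ((k : ℝ) + 1)).fun_add
    ((hA k).1.const_mul ((k : ℝ) + 1)⁻¹)
  have hi : Integrable (fun ω => V ξ ε k ω ^ 2) μ :=
    hR.mono' ((h.measurable_V k).pow_const 2).aestronglyMeasurable
      (ae_of_all _ fun ω => by rw [Real.norm_of_nonneg (sq_nonneg _)]; exact hle ω)
  refine ⟨hi, (integral_mono hi hR hle).trans ?_⟩
  rw [integral_add (integrable_const _) ((hA k).1.const_mul _), integral_const_mul]
  simp only [integral_const, probReal_univ, one_smul]
  have := mul_le_mul_of_nonneg_left (hA k).2 (inv_nonneg.2 hk.le)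
  have e : ((k : ℝ) + 1)⁻¹ * (A * ((k : ℝ) + 1) ^ 2) = A * ((k : ℝ) + 1) := by field_simp
  linarith

/-- Here Cauchy–Schwarz suffices, since `E V_k²` grows only linearly. -/
lemma exists_integral_sum_V_sq_le : ∃ C : ℝ, 0 ≤ C ∧ ∀ n : ℕ,
    Integrable (fun ω => (∑ k ∈ Finset.range n, V ξ ε k ω) ^ 2) μ ∧
      ∫ ω, (∑ k ∈ Finset.range n, V ξ ε k ω) ^ 2 ∂μ ≤ C * ((n : ℝ) + 1) ^ 3 := by
  obtain ⟨C, hC0, hC⟩ := h.exists_integral_V_sq_le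
  refine ⟨C, hC0, fun n => ?_⟩
  have hle : ∀ ω, (∑ k ∈ Finset.range n, V ξ ε k ω) ^ 2 ≤
      n * ∑ k ∈ Finset.range n, V ξ ε k ω ^ 2 := fun ω => by
    simpa using sq_sum_le_card_mul_sum_sq (s := Finset.range n) (f := fun k => V ξ ε k ω)
  have hR : Integrable (fun ω => n * ∑ k ∈ Finset.range n, V ξ ε k ω ^ 2) μ :=
    (integrable_finsetSum _ fun k _ => (hC k).1).const_mul _
  have hi : Integrable (fun ω => (∑ k ∈ Finset.range n, V ξ ε k ω) ^ 2) μ :=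
    hR.mono' ((Finset.measurable_fun_sum _ fun k _ =>
      h.measurable_V k).pow_const 2).aestronglyMeasurable
      (ae_of_all _ fun ω => by rw [Real.norm_of_nonneg (sq_nonneg _)]; exact hle ω)
  refine ⟨hi, (integral_mono hi hR hle).trans ?_⟩
  rw [integral_const_mul, integral_finsetSum _ fun k _ => (hC k).1]
  have h1 : ∑ k ∈ Finset.range n, ∫ ω, V ξ ε k ω ^ 2 ∂μ ≤ n * (C * ((n : ℝ) + 1)) := by
    have := Finset.sum_le_card_nsmul (Finset.range n) (fun k => ∫ ω, V ξ ε k ω ^ 2 ∂μ)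
      (C * ((n : ℝ) + 1)) (fun k hk => (hC k).2.trans (by
        have : (k : ℝ) ≤ n := by exact_mod_cast (Finset.mem_range.1 hk).le
        gcongr))
    simpa using this
  have hn : (0 : ℝ) ≤ n := n.cast_nonneg
  calc _ ≤ (n : ℝ) * (n * (C * ((n : ℝ) + 1))) := by gcongr
    _ ≤ ((n : ℝ) + 1) * (((n : ℝ) + 1) * (C * ((n : ℝ) + 1))) := by gcongr <;> linarith
    _ = _ := by ring

-- The recursion for `V` squared and summed. Since `V_0 = 0`, the sums of `V_k²` and of `V_{k+1}²`
-- differ only by `V_n²`.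
omit [IsProbabilityMeasure μ] in
lemma sum_V_sq_sub_sum_U (n : ℕ) (ω : Ω) :
    (1 - δ ^ 2) * ∑ k ∈ Finset.range n, V ξ ε (k + 1) ω ^ 2
      - (varAlong μ uTilde (ξ 0 0 0) + varAlong μ uTilde (ξ 0 0 1)) / 2
        * ∑ k ∈ Finset.range n, U ξ ε k ω =
    -δ ^ 2 * V ξ ε n ω ^ 2
      + (2 * δ * meanAlong μ uTilde (ε 0)
        + (varAlong μ uTilde (ξ 0 0 0) - varAlong μ uTilde (ξ 0 0 1)) / 2)
        * ∑ k ∈ Finset.range n, V ξ ε k ω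
      + ∑ k ∈ Finset.range n, sqDiff μ ξ ε δ (process ξ ε k ω) (process ξ ε (k + 1) ω)
      + n * (meanAlong μ uTilde (ε 0) ^ 2 + varAlong μ uTilde (ε 0)) := by
  induction n with
  | zero => simp [V_zero]
  | succ n ih =>
    simp only [Finset.sum_range_succ, mul_add]
    -- With `X_{n,1} = (U + V)/2` and `X_{n,2} = (U - V)/2`, the mean of the two variances becomes
    -- the coefficient of `U_n`.
    have hq : condVar μ ξ ε uTilde (process ξ ε n ω) =
        (varAlong μ uTilde (ξ 0 0 0) + varAlong μ uTilde (ξ 0 0 1)) / 2 * U ξ ε n ω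
        + (varAlong μ uTilde (ξ 0 0 0) - varAlong μ uTilde (ξ 0 0 1)) / 2 * V ξ ε n ω
        + varAlong μ uTilde (ε 0) := by
      rw [condVar, U_eq, V_eq, Fin.sum_univ_two]; ring
    have hV : innovation μ ξ ε uTilde (process ξ ε n ω) (process ξ ε (n + 1) ω) =
        V ξ ε (n + 1) ω - (δ * V ξ ε n ω + meanAlong μ uTilde (ε 0)) := h.innovation_uTilde _ _
    rw [sqDiff, hq, hV, ← V]
    push_cast
    linear_combination ih

lemma exists_integral_remainder_sq_le : ∃ C : ℝ, 0 ≤ C ∧ ∀ n : ℕ,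
    Integrable (fun ω => ((1 - δ ^ 2) * ∑ k ∈ Finset.range n, V ξ ε (k + 1) ω ^ 2
      - (varAlong μ uTilde (ξ 0 0 0) + varAlong μ uTilde (ξ 0 0 1)) / 2
        * ∑ k ∈ Finset.range n, U ξ ε k ω) ^ 2) μ ∧
    ∫ ω, ((1 - δ ^ 2) * ∑ k ∈ Finset.range n, V ξ ε (k + 1) ω ^ 2
      - (varAlong μ uTilde (ξ 0 0 0) + varAlong μ uTilde (ξ 0 0 1)) / 2
        * ∑ k ∈ Finset.range n, U ξ ε k ω) ^ 2 ∂μ ≤ C * ((n : ℝ) + 1) ^ 3 := by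
  obtain ⟨A, hA0, hA⟩ := h.exists_integral_V_pow_four_le
  obtain ⟨B, hB0, hB⟩ := h.exists_integral_sum_V_sq_le
  obtain ⟨C, hC0, hC⟩ := h.exists_integral_sum_sqDiff_sq_le
  set e := 2 * δ * meanAlong μ uTilde (ε 0)
        + (varAlong μ uTilde (ξ 0 0 0) - varAlong μ uTilde (ξ 0 0 1)) / 2 with he
  set f := meanAlong μ uTilde (ε 0) ^ 2 + varAlong μ uTilde (ε 0) with hf
  refine ⟨4 * A + 4 * e ^ 2 * B + 4 * C + 4 * f ^ 2, by positivity, fun n => ?_⟩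
  set R : Ω → ℝ := fun ω => (1 - δ ^ 2) * ∑ k ∈ Finset.range n, V ξ ε (k + 1) ω ^ 2
      - (varAlong μ uTilde (ξ 0 0 0) + varAlong μ uTilde (ξ 0 0 1)) / 2
        * ∑ k ∈ Finset.range n, U ξ ε k ω with hRdef
  have hmeas : Measurable R :=
    ((Finset.measurable_fun_sum _ fun k _ =>
      (h.measurable_V (k + 1)).pow_const 2).const_mul _).sub
      ((Finset.measurable_fun_sum _ fun k _ => h.measurable_U k).const_mul _)
  have hle : ∀ ω, R ω ^ 2 ≤ 4 * V ξ ε n ω ^ 4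
      + 4 * e ^ 2 * (∑ k ∈ Finset.range n, V ξ ε k ω) ^ 2
      + 4 * (∑ k ∈ Finset.range n,
        sqDiff μ ξ ε δ (process ξ ε k ω) (process ξ ε (k + 1) ω)) ^ 2
      + 4 * (n * f) ^ 2 := by
    intro ω
    have hR : R ω = _ := h.sum_V_sq_sub_sum_U n ω
    rw [hR, ← he, ← hf]
    set v := V ξ ε n ω
    set s := ∑ k ∈ Finset.range n, V ξ ε k ω
    set d := ∑ k ∈ Finset.range n, sqDiff μ ξ ε δ (process ξ ε k ω) (process ξ ε (k + 1) ω)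
    have hδ : δ ^ 4 ≤ 1 := by
      rw [← (show Even 4 by decide).pow_abs]
      exact pow_le_one₀ (abs_nonneg _) h.abs_lt_one.le
    have h1 : (-δ ^ 2 * v ^ 2) ^ 2 ≤ v ^ 4 := by
      have : (-δ ^ 2 * v ^ 2) ^ 2 = δ ^ 4 * v ^ 4 := by ring
      rw [this]
      exact mul_le_of_le_one_left (by positivity) hδ
    have h2 : ∀ a b c d : ℝ, (a + b + c + d) ^ 2 ≤ 4 * (a ^ 2 + b ^ 2 + c ^ 2 + d ^ 2) := by
      intro a b c d
      nlinarith [sq_nonneg (a - b), sq_nonneg (a - c), sq_nonneg (a - d), sq_nonneg (b - c),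
        sq_nonneg (b - d), sq_nonneg (c - d)]
    have h3 := h2 (-δ ^ 2 * v ^ 2) (e * s) d (n * f)
    have h4 : (e * s) ^ 2 = e ^ 2 * s ^ 2 := by ring
    linarith
  have i1 := (hA n).1.const_mul 4
  have i2 := (hB n).1.const_mul (4 * e ^ 2)
  have i3 := (hC n).1.const_mul 4
  have i4 : Integrable (fun _ : Ω => 4 * (n * f) ^ 2) μ := integrable_const _
  have hR := ((i1.fun_add i2).fun_add i3).fun_add i4
  have hi : Integrable (fun ω => R ω ^ 2) μ :=
    hR.mono' (hmeas.pow_const 2).aestronglyMeasurable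
      (ae_of_all _ fun ω => by rw [Real.norm_of_nonneg (sq_nonneg _)]; exact hle ω)
  refine ⟨hi, (integral_mono hi hR hle).trans ?_⟩
  rw [integral_add ((i1.fun_add i2).fun_add i3) i4, integral_add (i1.fun_add i2) i3,
    integral_add i1 i2]
  simp only [integral_const_mul, integral_const, probReal_univ, one_smul]
  have hn : (0 : ℝ) ≤ n := n.cast_nonneg
  have hc2 : ((n : ℝ) + 1) ^ 2 ≤ ((n : ℝ) + 1) ^ 3 :=
    pow_le_pow_right₀ (by linarith) (by norm_num)
  have h1 := (hA n).2.trans (mul_le_mul_of_nonneg_left hc2 hA0)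
  have h2 := mul_le_mul_of_nonneg_left (hB n).2 (show 0 ≤ 4 * e ^ 2 by positivity)
  have h4 : (n * f) ^ 2 ≤ f ^ 2 * ((n : ℝ) + 1) ^ 3 := by
    rw [mul_pow, mul_comm]
    refine mul_le_mul_of_nonneg_left (le_trans ?_ hc2) (sq_nonneg f)
    gcongr
    linarith
  linarith [(hC n).2]

end Critical

/-! ### Chebyshev's inequality and translation of the hypotheses. -/

/-- Chebyshev's inequality for random variables whose second moments grow at most cubically. -/
lemma tendstoInMeasure_of_integral_sq_le [IsProbabilityMeasure μ] {R : ℕ → Ω → ℝ} {C : ℝ}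
    (hi : ∀ n, Integrable (fun ω => R n ω ^ 2) μ)
    (hR : ∀ n, ∫ ω, R n ω ^ 2 ∂μ ≤ C * ((n : ℝ) + 1) ^ 3) :
    TendstoInMeasure μ (fun (n : ℕ) ω => ((n : ℝ) ^ 2)⁻¹ * R n ω) Filter.atTop
      (fun _ => (0 : ℝ)) := by
  rw [tendstoInMeasure_iff_measureReal_dist]
  intro r hr
  have hlim : Filter.Tendsto (fun n : ℕ => C * 8 / r ^ 2 * (1 / (n : ℝ))) Filter.atTop
      (nhds 0) := by
    have := (tendsto_one_div_atTop_nhds_zero_nat (𝕜 := ℝ)).const_mul (C * 8 / r ^ 2)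
    rwa [mul_zero] at this
  refine squeeze_zero' (Filter.Eventually.of_forall fun n => measureReal_nonneg) ?_ hlim
  -- For `n ≥ 1` one may divide by `n²` and use `(n + 1)³ ≤ 8n³`.
  filter_upwards [Filter.eventually_ge_atTop 1] with n hn
  have hn1 : (1 : ℝ) ≤ n := by exact_mod_cast hn
  have hn0 : (0 : ℝ) < n := by linarith
  have hsub : {ω | r ≤ dist (((n : ℝ) ^ 2)⁻¹ * R n ω) 0} ⊆
      {ω | (r * (n : ℝ) ^ 2) ^ 2 ≤ R n ω ^ 2} := by
    intro ω hω
    simp only [Set.mem_ofPred_eq, dist_zero_right, Real.norm_eq_abs, abs_mul, abs_inv] at hω ⊢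
    rw [abs_of_pos (show (0 : ℝ) < (n : ℝ) ^ 2 by positivity), inv_mul_eq_div,
      le_div_iff₀ (by positivity)] at hω
    rw [← sq_abs (R n ω)]
    exact pow_le_pow_left₀ (by positivity) hω 2
  have hC0 : 0 ≤ C := by
    have := (integral_nonneg fun ω => sq_nonneg (R 0 ω)).trans (hR 0)
    simpa using this
  have hch := mul_meas_ge_le_integral_of_nonneg (ae_of_all μ fun ω => sq_nonneg (R n ω)) (hi n)
    ((r * (n : ℝ) ^ 2) ^ 2)
  have hcube : C * ((n : ℝ) + 1) ^ 3 ≤ C * 8 * (n : ℝ) ^ 3 := by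
    have : ((n : ℝ) + 1) ^ 3 ≤ (2 * (n : ℝ)) ^ 3 := by gcongr; linarith
    nlinarith
  refine (measureReal_mono hsub).trans ?_
  have h3 := hch.trans ((hR n).trans hcube)
  rw [mul_comm, ← le_div_iff₀ (by positivity)] at h3
  refine h3.trans (le_of_eq ?_)
  field_simp

lemma le_euclNorm (y : Fin 2 → ℕ) (ℓ : Fin 2) : (y ℓ : ℝ) ≤ euclNorm y := by
  have := PiLp.norm_apply_le (WithLp.toLp 2 (toReal y) : EuclideanSpace ℝ (Fin 2)) ℓ
  simpa [toReal, euclNorm] using this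

lemma memLp_four_of_integrable_euclNorm [IsProbabilityMeasure μ] {Y : Ω → Fin 2 → ℕ}
    (hY : Measurable Y) (hi : Integrable (fun ω => euclNorm (Y ω) ^ 8) μ) (ℓ : Fin 2) :
    MemLp (fun ω => (Y ω ℓ : ℝ)) 4 μ := by
  have hm : Measurable fun ω => (Y ω ℓ : ℝ) :=
    (measurable_of_countable fun y : Fin 2 → ℕ => (y ℓ : ℝ)).comp hY
  have h8 : MemLp (fun ω => (Y ω ℓ : ℝ)) 8 μ := by
    have h1 : Integrable (fun ω => ‖(Y ω ℓ : ℝ)‖ ^ 8) μ :=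
      hi.mono' (hm.norm.pow_const 8).aestronglyMeasurable (ae_of_all _ fun ω => by
        simp only [Real.norm_natCast, norm_pow]
        exact pow_le_pow_left₀ (by positivity) (le_euclNorm _ _) 8)
    refine (integrable_norm_rpow_iff hm.aestronglyMeasurable (by norm_num) (by norm_num)).1 ?_
    simpa only [ENNReal.toReal_ofNat, Real.rpow_ofNat] using h1
  exact h8.mono_exponent (by norm_num)

lemma meanAlong_eq {w : Fin 2 → ℝ} {Y : Ω → Fin 2 → ℕ}
    (hY : ∀ ℓ, Integrable (fun ω => (Y ω ℓ : ℝ)) μ) :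
    meanAlong μ w Y = w 0 * meanVec μ Y 0 + w 1 * meanVec μ Y 1 := by
  simp only [meanAlong, dotProduct_toReal, meanVec]
  rw [integral_add ((hY 0).const_mul _) ((hY 1).const_mul _), integral_const_mul,
    integral_const_mul]

/-- Identifies the variances in the recursion with the quadratic form of the covariance matrix. -/
lemma varAlong_uTilde [IsProbabilityMeasure μ] {Y : Ω → Fin 2 → ℕ}
    (hY : ∀ ℓ, MemLp (fun ω => (Y ω ℓ : ℝ)) 2 μ) :
    varAlong μ uTilde Y = (covMatrix μ Y).mulVec uTilde ⬝ᵥ uTilde := by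
  simp only [varAlong, uTilde_dotProduct]
  rw [variance_fun_sub (hY 0) (hY 1), ← covariance_self (hY 0).1.aemeasurable,
    ← covariance_self (hY 1).1.aemeasurable]
  simp only [covMatrix, Matrix.mulVec, dotProduct, Fin.sum_univ_two, Matrix.of_apply, uTilde,
    Matrix.cons_val_zero, Matrix.cons_val_one]
  rw [covariance_comm (fun ω => (Y ω 1 : ℝ)) (fun ω => (Y ω 0 : ℝ))]
  ring

end

end GWI

theorem lemmaA2 {Ω : Type*} [MeasurableSpace Ω] (μ : Measure Ω) [IsProbabilityMeasure μ]
    (ξ : ℕ → ℕ → Fin 2 → Ω → (Fin 2 → ℕ)) (ε : ℕ → Ω → (Fin 2 → ℕ))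
    (hξ_meas : ∀ k j i, Measurable (ξ k j i)) (hε_meas : ∀ k, Measurable (ε k))
    (h_indep : iIndepFun (GWI.family ξ ε) μ)
    (hξ_ident : ∀ k j i, IdentDistrib (ξ k j i) (ξ 0 0 i) μ μ)
    (hε_ident : ∀ k, IdentDistrib (ε k) (ε 0) μ μ)
    (hξ_mom : ∀ i, Integrable (fun ω => GWI.euclNorm (ξ 0 0 i ω) ^ 8) μ)
    (hε_mom : Integrable (fun ω => GWI.euclNorm (ε 0 ω) ^ 8) μ)
    (α β : ℝ) (hα : α ∈ Set.Ioo (0 : ℝ) 1) (hβ : β ∈ Set.Ioo (0 : ℝ) 1) (hαβ : α + β = 1)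
    (h_mean : GWI.offspringMean μ ξ = !![α, β; β, α])
    (hε_mean : GWI.meanVec μ (ε 0) ≠ 0) :
    TendstoInMeasure μ
      (fun (n : ℕ) (ω : Ω) =>
        ((n : ℝ) ^ 2)⁻¹ *
          (∑ k ∈ Finset.Icc 1 n, GWI.V ξ ε k ω ^ 2
            - (GWI.avgOffspringCov μ ξ).mulVec GWI.uTilde ⬝ᵥ GWI.uTilde / (4 * α * β)
              * ∑ k ∈ Finset.Icc 1 n, GWI.U ξ ε (k - 1) ω))
      Filter.atTop (fun _ => (0 : ℝ)) := by
  have hξ4 : ∀ i ℓ, MemLp (fun ω => (ξ 0 0 i ω ℓ : ℝ)) 4 μ := fun i ℓ =>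
    GWI.memLp_four_of_integrable_euclNorm (hξ_meas 0 0 i) (hξ_mom i) ℓ
  have hε4 : ∀ ℓ, MemLp (fun ω => (ε 0 ω ℓ : ℝ)) 4 μ := fun ℓ =>
    GWI.memLp_four_of_integrable_euclNorm (hε_meas 0) hε_mom ℓ
  have hmean : ∀ ℓ i, GWI.meanVec μ (ξ 0 0 i) ℓ = !![α, β; β, α] ℓ i := fun ℓ i => by
    rw [← h_mean]; rfl
  have hal : ∀ w i, GWI.meanAlong μ w (ξ 0 0 i) =
      w 0 * !![α, β; β, α] 0 i + w 1 * !![α, β; β, α] 1 i := fun w i => by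
    rw [GWI.meanAlong_eq fun ℓ => (hξ4 i ℓ).integrable (by norm_num), hmean, hmean]
  have h : GWI.Critical μ ξ ε (α - β) :=
    { meas_offspring := hξ_meas
      meas_immigration := hε_meas
      indep := h_indep
      ident_offspring := hξ_ident
      ident_immigration := hε_ident
      memLp_offspring := hξ4
      memLp_immigration := hε4
      mean_oneVec := fun i => by
        rw [hal]; fin_cases i <;> simp [GWI.oneVec] <;> linarith
      mean_uTilde_zero := by rw [hal]; simp [GWI.uTilde]; ring
      mean_uTilde_one := by rw [hal]; simp [GWI.uTilde]; ring
      abs_lt_one := by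
        rw [abs_lt]; constructor <;> linarith [hα.1, hα.2, hβ.1, hβ.2] }
  obtain ⟨C, -, hC⟩ := h.exists_integral_remainder_sq_le
  have hpos : 0 < 4 * α * β := by have := mul_pos hα.1 hβ.1; linarith
  have hδ : 1 - (α - β) ^ 2 = 4 * α * β := by
    have : (α + β) ^ 2 = 1 := by rw [hαβ]; norm_num
    linear_combination -this
  have hc : (GWI.avgOffspringCov μ ξ).mulVec GWI.uTilde ⬝ᵥ GWI.uTilde =
      (GWI.varAlong μ GWI.uTilde (ξ 0 0 0) + GWI.varAlong μ GWI.uTilde (ξ 0 0 1)) / 2 := by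
    rw [GWI.varAlong_uTilde fun ℓ => (hξ4 0 ℓ).mono_exponent (by norm_num),
      GWI.varAlong_uTilde fun ℓ => (hξ4 1 ℓ).mono_exponent (by norm_num),
      GWI.avgOffspringCov, Matrix.smul_mulVec, Matrix.add_mulVec, smul_dotProduct,
      add_dotProduct, smul_eq_mul]
    ring
  have hsum : ∀ (f : ℕ → ℝ) n, ∑ k ∈ Finset.Icc 1 n, f k = ∑ k ∈ Finset.range n, f (k + 1) :=
    fun f n => by
      rw [Finset.range_eq_Ico, Finset.sum_Ico_add' f 0 n 1]
      rfl
  -- Division by `4αβ = 1 - δ²` turns the remainder bounded above into the quantity of the theorem.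
  have hR : ∀ n ω, ∑ k ∈ Finset.Icc 1 n, GWI.V ξ ε k ω ^ 2
      - (GWI.avgOffspringCov μ ξ).mulVec GWI.uTilde ⬝ᵥ GWI.uTilde / (4 * α * β)
        * ∑ k ∈ Finset.Icc 1 n, GWI.U ξ ε (k - 1) ω =
      (4 * α * β)⁻¹ * ((1 - (α - β) ^ 2) * ∑ k ∈ Finset.range n, GWI.V ξ ε (k + 1) ω ^ 2
      - (GWI.varAlong μ GWI.uTilde (ξ 0 0 0) + GWI.varAlong μ GWI.uTilde (ξ 0 0 1)) / 2
        * ∑ k ∈ Finset.range n, GWI.U ξ ε k ω) := by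
    intro n ω
    rw [hc, hδ, hsum (fun k => GWI.V ξ ε k ω ^ 2), hsum (fun k => GWI.U ξ ε (k - 1) ω)]
    simp only [Nat.add_sub_cancel]
    rw [mul_sub, inv_mul_cancel_left₀ hpos.ne']
    ring
  refine GWI.tendstoInMeasure_of_integral_sq_le (C := ((4 * α * β)⁻¹) ^ 2 * C) ?_ ?_
  · intro n
    simp_rw [hR, mul_pow (4 * α * β)⁻¹]
    exact (hC n).1.const_mul _
  · intro n
    simp_rw [hR, mul_pow (4 * α * β)⁻¹]
    rw [integral_const_mul, mul_assoc (_ ^ 2)]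
    exact mul_le_mul_of_nonneg_left (hC n).2 (by positivity)
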